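/- Let $\phi(t)=\max\{0,t\}$ act entrywise. For depth $L\ge 1$, width $m$, input dimension $p$, output dimension $d$ and scaling factor $\tau>0$, consider the residual network $$h_0=\phi(Ax),\qquad h_l=\phi(h_{l-1}+\tau W_l h_{l-1})\ (1\le l\le L-1),\qquad h_L=\phi(W_Lh_{L-1}),\qquad \text{output } Bh_L,$$ with $A\in\mathbb R^{m\times p}$, $W_l\in\mathbb R^{m\times m}$, $B\in\mathbb R^{d\times m}$. For data $(x_i,y_i^*)_{i=1}^n$ with $x_i\in\mathbb R^p$, $\|x_i\|=1$, $y_i^*\in\mathbb R^d$, write $h_{i,l}$ for $h_l$ at the input $x_i$ and let $$F(\overrightarrow W)=\sum_{i=1}^n F_i(\overrightarrow W),\qquad F_i(\overrightarrow W)=\tfrac12\|Bh_{i,L}-y_i^*\|^2,\qquad \overrightarrow W=(W_1,\dots,W_L).$$ The gradients $\nabla_{W_l}F=\sum_i\nabla_{W_l}F_i$ are those computed by back-propagation: with $v_i=Bh_{i,L}-y_i^*$ and $D_{i,l}$ the diagonal matrix with entries $\mathbf 1\{(g_{i,l})_k\ge 0\}$, where $g_{i,l}$ is the pre-activation of layer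 $l$, $$\nabla_{W_L}F_i=(D_{i,L}B^Tv_i)\,h_{i,L-1}^T,\qquad \nabla_{W_l}F_i=\tau\,(D_{i,l}b_{i,l})\,h_{i,l-1}^T\ (1\le l\le L-1),$$ $$b_{i,L-1}=W_L^TD_{i,L}B^Tv_i,\qquad b_{i,l}=(I+\tau W_{l+1})^TD_{i,l+1}b_{i,l+1}\ (0\le l\le L-2).$$ At initialization all entries of $A$, of $W^{(0)}_1,\dots,W^{(0)}_L$ and of $B$ are independent, those of $A$ and $W_l^{(0)}$ with law $\mathcal N(0,2/m)$ and those of $B$ with law $\mathcal N(0,2/d)$. **Theorem.** There are absolute constants $c_0,C_0,C,c>0$ such that the following holds for all $n,p,d,m,L$ with $d\ge 1$, $L\ge 1$, all data as above and all $\tau>0$ with $$m\ge \max\{L,\,C_0 d\},\qquad \tau\sqrt L\,\log m\le c_0 .$$ With probability at least $1-e^{-cm}$ over the randomness of $\overrightarrow W^{(0)},A,B$, for every $\omega\in[0,1]$ and every $\overrightarrow W$ with $$\|W_L-W_L^{(0)}\|_2\le\omega,\qquad \|W_l-W_l^{(0)}\|_2\le \omega\min\Big\{1,\frac1{\tau L}\Big\}\quad(1\le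 l\le L-1)$$ (spectral norms), one has, for every $l\in\{1,\dots,L-1\}$, $$\|\nabla_{W_l}F(\overrightarrow W)\|_F^2\le C\,\frac{F(\overrightarrow W)}{d}\,\tau^2mn,\qquad \|\nabla_{W_L}F(\overrightarrow W)\|_F^2\le C\,\frac{F(\overrightarrow W)}{d}\,mn .$$ In particular, if $c_0\le\frac12$ and $m\ge3$ (as may be assumed), this covers all $\overrightarrow W$ with $\|W_L-W_L^{(0)}\|_2\le\omega$ and $\|W_l-W_l^{(0)}\|_2\le\tau\omega$ for $l\le L-1$; and if $\tau\le 1/L$ it covers all $\overrightarrow W$ with $\max_{l\le L}\|W_l-W_l^{(0)}\|_2\le\omega$. -/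

import Mathlib

open MeasureTheory ProbabilityTheory
open scoped NNReal ENNReal Matrix

noncomputable section

namespace ResNet

/-- The spectral norm of a real square matrix: the operator norm for the Euclidean norm. -/
def spectralNorm {m : ℕ} (M : Matrix (Fin m) (Fin m) ℝ) : ℝ :=
  ‖Matrix.toEuclideanCLM (n := Fin m) (𝕜 := ℝ) M‖

/-- The square of the Frobenius norm. -/
def frobSq {m k : ℕ} (M : Matrix (Fin m) (Fin k) ℝ) : ℝ :=
  ∑ i, ∑ j, M i j ^ 2

/-- The entrywise ReLU. -/
def relu {m : ℕ} (v : Fin m → ℝ) : Fin m → ℝ := fun k => max 0 (v k)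

/-- The diagonal sign matrix `D` of a pre-activation `g`: `D k k = 1` if `0 ≤ g k`, else `0`. -/
def signDiag {m : ℕ} (g : Fin m → ℝ) : Matrix (Fin m) (Fin m) ℝ :=
  Matrix.diagonal fun k => if 0 ≤ g k then 1 else 0

/-- Trainable weights `(W_1, …, W_L)` of a network of depth `L = K + 1`, that is, with `K = L - 1`
residual layers. `W k.castSucc` (for `k : Fin K`) is the weight `W_{k+1}` of the residual layer
`k + 1`, and `W (Fin.last K)` is the weight `W_L` of the fully connected top layer. -/
abbrev Weights (m K : ℕ) : Type := Fin (K + 1) → Matrix (Fin m) (Fin m) ℝ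

section Network

variable {m p d K : ℕ} (τ : ℝ) (A : Matrix (Fin m) (Fin p) ℝ) (B : Matrix (Fin d) (Fin m) ℝ)
  (W : Weights m K) (x : EuclideanSpace ℝ (Fin p))

/-- The representations `h_0, …, h_{L-1}`: `h_0 = φ(A x)` and
`h_{k+1} = φ(h_k + τ W_{k+1} h_k)`. -/
def hiddenRep : Fin (K + 1) → Fin m → ℝ :=
  Fin.induction (relu (A *ᵥ x.ofLp)) fun k h => relu (h + τ • (W k.castSucc *ᵥ h))

/-- The pre-activation `g_{k+1} = h_k + τ W_{k+1} h_k` of the residual layer `k + 1`. -/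
def preAct (k : Fin K) : Fin m → ℝ :=
  hiddenRep τ A W x k.castSucc + τ • (W k.castSucc *ᵥ hiddenRep τ A W x k.castSucc)

/-- The pre-activation `g_L = W_L h_{L-1}` of the top layer. -/
def topPreAct : Fin m → ℝ := W (Fin.last K) *ᵥ hiddenRep τ A W x (Fin.last K)

/-- The network output `B h_L`, where `h_L = φ(g_L)`. -/
def output : EuclideanSpace ℝ (Fin d) := WithLp.toLp 2 (B *ᵥ relu (topPreAct τ A W x))

/-- The signal `D_L Bᵀ v` at the pre-activation of the top layer. -/
def backTop (v : EuclideanSpace ℝ (Fin d)) : Fin m → ℝ :=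
  signDiag (topPreAct τ A W x) *ᵥ (Bᵀ *ᵥ v.ofLp)

/-- Back-propagation of `v` to `h_0, …, h_{L-1}`: to `h_{L-1}` it is `W_Lᵀ D_L Bᵀ v`, and to `h_k`
it is `(I + τ W_{k+1})ᵀ D_{k+1}` applied to the signal at `h_{k+1}`. -/
def backHidden (v : EuclideanSpace ℝ (Fin d)) : Fin (K + 1) → Fin m → ℝ :=
  Fin.reverseInduction (motive := fun _ => Fin m → ℝ)
    ((W (Fin.last K))ᵀ *ᵥ backTop τ A B W x v)
    fun k b => (1 + τ • W k.castSucc)ᵀ *ᵥ (signDiag (preAct τ A W x k) *ᵥ b)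

/-- Back-propagation of `v` to the weight `W_{k+1}` of a residual layer:
`τ (D_{k+1} b_{k+1}) h_kᵀ`, with `b_{k+1}` the signal at `h_{k+1}`. -/
def backResidual (v : EuclideanSpace ℝ (Fin d)) (k : Fin K) : Matrix (Fin m) (Fin m) ℝ :=
  τ • Matrix.vecMulVec (signDiag (preAct τ A W x k) *ᵥ backHidden τ A B W x v k.succ)
    (hiddenRep τ A W x k.castSucc)

/-- Back-propagation of `v` to the top weight `W_L`: `(D_L Bᵀ v) h_{L-1}ᵀ`. -/
def backTopWeight (v : EuclideanSpace ℝ (Fin d)) : Matrix (Fin m) (Fin m) ℝ :=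
  Matrix.vecMulVec (backTop τ A B W x v) (hiddenRep τ A W x (Fin.last K))

end Network

section Objective

variable {m p d K n : ℕ} (τ : ℝ) (x : Fin n → EuclideanSpace ℝ (Fin p))
  (y : Fin n → EuclideanSpace ℝ (Fin d)) (A : Matrix (Fin m) (Fin p) ℝ)
  (B : Matrix (Fin d) (Fin m) ℝ) (W : Weights m K)

/-- The training objective `F(W) = ∑ i, ½ ‖B h_{i,L} - y_i‖²`. -/
def objective : ℝ := ∑ i, 1 / 2 * ‖output τ A B W (x i) - y i‖ ^ 2

/-- The gradient of `F` in the weight `W_{k+1}` of a residual layer, computed by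
back-propagation. -/
def gradResidual (k : Fin K) : Matrix (Fin m) (Fin m) ℝ :=
  ∑ i, backResidual τ A B W (x i) (output τ A B W (x i) - y i) k

/-- The gradient of `F` in the top weight `W_L`, computed by back-propagation. -/
def gradTop : Matrix (Fin m) (Fin m) ℝ :=
  ∑ i, backTopWeight τ A B W (x i) (output τ A B W (x i) - y i)

end Objective

/-- `W` lies in the spectral-norm neighbourhood of radius `w` of `W₀`: the top weight moves by at
most `w`, and each residual weight by at most `min {w, w / (τ L)}`, where `L = K + 1`. -/
def InNeighborhood {m K : ℕ} (τ w : ℝ) (W₀ W : Weights m K) : Prop :=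
  spectralNorm (W (Fin.last K) - W₀ (Fin.last K)) ≤ w ∧
    ∀ k : Fin K, spectralNorm (W k.castSucc - W₀ k.castSucc) ≤ min w (w / (τ * (K + 1 : ℕ)))

/-- The entries of `(A, (W_1, …, W_L), B)`. -/
abbrev InitSpace (m p d K : ℕ) : Type :=
  (Fin m → Fin p → ℝ) × (Fin (K + 1) → Fin m → Fin m → ℝ) × (Fin d → Fin m → ℝ)

/-- The law of the initialization: all entries are independent, those of `A` and of the `W_l` have
law `N(0, 2/m)`, those of `B` have law `N(0, 2/d)`. -/
def initLaw (m p d K : ℕ) : Measure (InitSpace m p d K) :=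
  (Measure.pi fun _ => Measure.pi fun _ => gaussianReal 0 (2 / (m : ℝ≥0))).prod
    ((Measure.pi fun _ => Measure.pi fun _ => Measure.pi fun _ =>
        gaussianReal 0 (2 / (m : ℝ≥0))).prod
      (Measure.pi fun _ => Measure.pi fun _ => gaussianReal 0 (2 / (d : ℝ≥0))))

/-- The matrix `A` of an initialization. -/
def InitSpace.A {m p d K : ℕ} (θ : InitSpace m p d K) : Matrix (Fin m) (Fin p) ℝ :=
  Matrix.of θ.1

/-- The weights `W⁽⁰⁾` of an initialization. -/
def InitSpace.W {m p d K : ℕ} (θ : InitSpace m p d K) : Weights m K :=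
  fun l => Matrix.of (θ.2.1 l)

/-- The matrix `B` of an initialization. -/
def InitSpace.B {m p d K : ℕ} (θ : InitSpace m p d K) : Matrix (Fin d) (Fin m) ℝ :=
  Matrix.of θ.2.2

/-- The gradient bounds, with constant `C`, hold at all weights of every neighbourhood of radius
`w ∈ [0, 1]` of the initialization `θ`. -/
def GradientUpperBound {m p d K n : ℕ} (C τ : ℝ) (x : Fin n → EuclideanSpace ℝ (Fin p))
    (y : Fin n → EuclideanSpace ℝ (Fin d)) (θ : InitSpace m p d K) : Prop :=
  ∀ w ∈ Set.Icc (0 : ℝ) 1, ∀ W : Weights m K, InNeighborhood τ w θ.W W →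
    (∀ k : Fin K, frobSq (gradResidual τ x y θ.A θ.B W k) ≤
      C * (objective τ x y θ.A θ.B W / d * (τ ^ 2 * m * n))) ∧
    frobSq (gradTop τ x y θ.A θ.B W) ≤ C * (objective τ x y θ.A θ.B W / d * (m * n))

end ResNet

end

/-! Each gradient is a sum over the data of rank-one matrices. By Cauchy-Schwarz its squared
Frobenius norm is at most the total energy of the back-propagated signals times that of the hidden
representations. So it suffices that neither propagation amplifies norms by more than a constant,
for all weights of the neighbourhood at once. Multiplying the norms of the layers would allow growth
`(1 + Cτ)^L`, which is too much when `τ` is only slightly below `1/√L`. Cancellation between layers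
is needed, although the signals depend on the weights.

The only fact about the random residual layers that is used is `IntervalSumBound`: the sum of the
initial weights over any interval of `T` layers has norm `O(√T)`. The rest is deterministic. A
forward or backward signal is a path `u (l+1) = u l + n l - δ l` in which every coordinate either
does not jump or is reset to `0`, by the ReLU or by the sign mask. Then `u (l+1)` and `δ l` are
orthogonal, so `∑ ‖δ l‖²` is dissipated in the energy balance. The energy input `2τ ∑ ⟨u l, w l (u
l)⟩` is bounded by dyadic chaining (`abs_sum_inner_sub_le`), with an error governed by the dyadic
variation of `u`. This variation is bounded by the dissipation and by maximal partial sums of the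
increments (`sq_norm_sub_le_of_resets`, `exists_maximal_bound`), and chaining bounds those by the
variation again. When `τ √L log m` is small, both circles close by absorption
(`sq_norm_endpoint_le`).

Perturbing the weights adds at most a relative `1/L` per layer, which a geometric damping absorbs at
the price of a constant (`sq_norm_le_of_residual_path`). The tails of operator norms come from
exponential moments averaged over balls (`measure_opNorm_gt_le`). Of the first layer only an average
over the data is needed, so no union bound over the data occurs. -/

namespace ResNet

/-! ### Scalar paths with resets -/

/-- A real path that moves by increments `n` and is sometimes reset to `0` (with jump `δ`) stays
close to its starting point, up to the jumps and the maximal partial sum of the increments. -/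
theorem sq_sub_le_of_resets (u n δ : ℕ → ℝ) (hu : ∀ l, u (l + 1) = u l + n l - δ l)
    (hδ : ∀ l, δ l = 0 ∨ u (l + 1) = 0) (M : ℝ) (T : ℕ)
    (hM : ∀ l ≤ T, |∑ j ∈ Finset.range l, n j| ≤ M) :
    (u T - u 0) ^ 2 ≤ 2 * ∑ l ∈ Finset.range T, δ l ^ 2 + 18 * M ^ 2 := by
  have hM0 : 0 ≤ M := by simpa using hM 0 (Nat.zero_le _)
  -- Either no jump has occurred yet, or the first reset has bounded `u 0` and `k` is the time of
  -- the latest reset. Only the jump at the first reset enters, so the jumps are paid in `ℓ²` and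
  -- not in `ℓ¹`.
  have key : ∀ l ≤ T, u l - u 0 = ∑ j ∈ Finset.range l, n j ∨
      (|u 0| ≤ √(∑ j ∈ Finset.range l, δ j ^ 2) + M ∧
        ∃ k ≤ l, u l = ∑ j ∈ Finset.range l, n j - ∑ j ∈ Finset.range k, n j) := by
    intro l
    induction l with
    | zero => intro _; left; simp
    | succ l ih =>
      intro hl
      have hnn : 0 ≤ ∑ j ∈ Finset.range l, δ j ^ 2 := Finset.sum_nonneg fun _ _ => sq_nonneg _
      rcases ih (by omega) with h | ⟨h2, k, hk, h3⟩
      · rcases hδ l with h0 | h0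
        · left
          rw [hu, h0, Finset.sum_range_succ]; linarith
        · right
          have e : u 0 = δ l - ∑ j ∈ Finset.range (l + 1), n j := by
            rw [Finset.sum_range_succ]; linarith [hu l]
          have hb := hM (l + 1) hl
          refine ⟨?_, l + 1, le_rfl, by rw [h0]; ring⟩
          · rw [e]
            refine (abs_sub _ _).trans (add_le_add ?_ hb)
            rw [Finset.sum_range_succ (fun j => δ j ^ 2), ← Real.sqrt_sq_eq_abs]
            exact Real.sqrt_le_sqrt (by linarith)
      · right
        have hmono : ∑ j ∈ Finset.range l, δ j ^ 2 ≤ ∑ j ∈ Finset.range (l + 1), δ j ^ 2 := by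
          rw [Finset.sum_range_succ]; linarith [sq_nonneg (δ l)]
        refine ⟨h2.trans (by linarith [Real.sqrt_le_sqrt hmono]), ?_⟩
        rcases hδ l with h0 | h0
        · exact ⟨k, by omega, by rw [hu, h0, h3, Finset.sum_range_succ n l]; ring⟩
        · exact ⟨l + 1, le_rfl, by rw [h0]; ring⟩
  have hnn : 0 ≤ ∑ j ∈ Finset.range T, δ j ^ 2 := Finset.sum_nonneg fun _ _ => sq_nonneg _
  rcases key T le_rfl with h | ⟨h2, k, hk, h3⟩
  · rw [h]
    have := sq_le_sq' (by linarith [neg_abs_le (∑ j ∈ Finset.range T, n j), hM T le_rfl])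
      ((le_abs_self _).trans (hM T le_rfl))
    nlinarith
  · have hT := hM T le_rfl
    have hk' := hM k hk
    have h4 : |u T - u 0| ≤ √(∑ j ∈ Finset.range T, δ j ^ 2) + 3 * M := by
      refine (abs_sub _ _).trans ?_
      have : |u T| ≤ 2 * M := by rw [h3]; exact (abs_sub _ _).trans (by linarith)
      linarith
    have h5 := pow_le_pow_left₀ (abs_nonneg _) h4 2
    rw [sq_abs] at h5
    have h6 := Real.sq_sqrt hnn
    nlinarith [sq_nonneg (√(∑ j ∈ Finset.range T, δ j ^ 2) - 3 * M)]

/-! ### Dyadic variation and chaining -/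

variable {ι : Type*} [Fintype ι]

/-- The sum of the squared increments of a path over the left halves of all dyadic subintervals of
`[a, a + 2 ^ j)`. -/
noncomputable def dyadicVar (u : ℕ → EuclideanSpace ℝ ι) : ℕ → ℕ → ℝ
  | _, 0 => 0
  | a, j + 1 => ‖u (a + 2 ^ j) - u a‖ ^ 2 + dyadicVar u a j + dyadicVar u (a + 2 ^ j) j

theorem dyadicVar_nonneg (u : ℕ → EuclideanSpace ℝ ι) (a j : ℕ) : 0 ≤ dyadicVar u a j := by
  induction j generalizing a with
  | zero => exact le_rfl
  | succ j ih => exact add_nonneg (add_nonneg (sq_nonneg _) (ih _)) (ih _)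

theorem sum_range_two_pow_succ {M : Type*} [AddCommMonoid M] (f : ℕ → M) (a j : ℕ) :
    ∑ l ∈ Finset.range (2 ^ (j + 1)), f (a + l) =
      ∑ l ∈ Finset.range (2 ^ j), f (a + l) + ∑ l ∈ Finset.range (2 ^ j), f (a + 2 ^ j + l) := by
  rw [pow_succ, mul_two, Finset.sum_range_add]
  simp [add_assoc]

/-- Cauchy-Schwarz, in the form in which errors of two halves of a dyadic interval add up. -/
theorem sqrt_dyadic_add_le (j : ℕ) {V₁ V₂ : ℝ} (D : ℝ) (h₁ : 0 ≤ V₁) (h₂ : 0 ≤ V₂) :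
    √(j * 2 ^ j * V₁) + √(j * 2 ^ j * V₂) + √(2 ^ j) * D ≤
      √((j + 1 : ℕ) * 2 ^ (j + 1) * (D ^ 2 + V₁ + V₂)) := by
  apply Real.le_sqrt_of_sq_le
  have e0 : (0 : ℝ) ≤ j * 2 ^ j := by positivity
  rw [Real.sqrt_mul e0, Real.sqrt_mul e0]
  have a1 := Real.sq_sqrt e0
  have a2 := Real.sq_sqrt h₁
  have a3 := Real.sq_sqrt h₂
  have a4 : √(2 ^ j : ℝ) ^ 2 = 2 ^ j := Real.sq_sqrt (by positivity)
  set p := √((j : ℝ) * 2 ^ j)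
  set q := √(2 ^ j : ℝ)
  set x := √V₁
  set y := √V₂
  rw [← a2, ← a3]
  have e : (((j + 1 : ℕ) : ℝ) * 2 ^ (j + 1)) = 2 * p ^ 2 + 2 * q ^ 2 := by
    rw [a1, a4]; push_cast; ring
  rw [e]
  nlinarith [sq_nonneg (p * (x - y)), sq_nonneg (p * D - q * x), sq_nonneg (p * D - q * y),
    sq_nonneg (q * D), sq_nonneg (q * x), sq_nonneg (q * y)]

section Chaining

variable (u : ℕ → EuclideanSpace ℝ ι)
  (w : ℕ → EuclideanSpace ℝ ι →L[ℝ] EuclideanSpace ℝ ι) {σ U : ℝ}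

/-- Freezing `u` at the left endpoint lets the operators be summed first, where they cancel. To
merge two halves only the base point of the right half has to move, from the midpoint to `a`; this
costs `σ √(2 ^ j)` times the increment recorded by `dyadicVar`. -/
theorem norm_sum_apply_sub_le (hσ : 0 ≤ σ)
    (hS : ∀ a T : ℕ, ‖∑ l ∈ Finset.range T, w (a + l)‖ ≤ σ * √T) (a j : ℕ) :
    ‖∑ l ∈ Finset.range (2 ^ j), w (a + l) (u (a + l)) -
      (∑ l ∈ Finset.range (2 ^ j), w (a + l)) (u a)‖ ≤ σ * √(j * 2 ^ j * dyadicVar u a j) := by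
  induction j generalizing a with
  | zero => simp [dyadicVar]
  | succ j ih =>
    rw [sum_range_two_pow_succ (fun l => w l (u l)), sum_range_two_pow_succ w]
    have h1 := ih a
    have h2 := ih (a + 2 ^ j)
    have h3 : ‖(∑ l ∈ Finset.range (2 ^ j), w (a + 2 ^ j + l)) (u (a + 2 ^ j) - u a)‖ ≤
        σ * √(2 ^ j) * ‖u (a + 2 ^ j) - u a‖ := by
      refine (ContinuousLinearMap.le_opNorm _ _).trans ?_
      gcongr
      simpa using hS (a + 2 ^ j) (2 ^ j)
    have h4 := sqrt_dyadic_add_le j ‖u (a + 2 ^ j) - u a‖ (dyadicVar_nonneg u a j)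
      (dyadicVar_nonneg u (a + 2 ^ j) j)
    rw [dyadicVar]
    refine le_trans ?_ (mul_le_mul_of_nonneg_left h4 hσ)
    have e : ∀ x y p q r : EuclideanSpace ℝ ι, x + y - (p + q) = (x - p) + (y - r) + (r - q) := by
      intros; abel
    rw [add_apply, e _ _ _ _
      ((∑ l ∈ Finset.range (2 ^ j), w (a + 2 ^ j + l)) (u (a + 2 ^ j))), ← map_sub]
    refine (norm_add₃_le).trans ?_
    rw [mul_add, mul_add, ← mul_assoc]
    gcongr

theorem sq_norm_sum_apply_le (hσ : 0 ≤ σ)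
    (hS : ∀ a T : ℕ, ‖∑ l ∈ Finset.range T, w (a + l)‖ ≤ σ * √T) (hU : ∀ l, ‖u l‖ ≤ U)
    (a j : ℕ) :
    ‖∑ l ∈ Finset.range (2 ^ j), w (a + l) (u (a + l))‖ ^ 2 ≤
      2 * σ ^ 2 * 2 ^ j * (U ^ 2 + j * dyadicVar u a j) := by
  have h1 := norm_sum_apply_sub_le u w hσ hS a j
  have h2 : ‖(∑ l ∈ Finset.range (2 ^ j), w (a + l)) (u a)‖ ≤ σ * √(2 ^ j) * U := by
    refine (ContinuousLinearMap.le_opNorm _ _).trans ?_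
    refine mul_le_mul ?_ (hU a) (norm_nonneg _) (by positivity)
    simpa using hS a (2 ^ j)
  have h3 := norm_le_norm_add_norm_sub' (∑ l ∈ Finset.range (2 ^ j), w (a + l) (u (a + l)))
    ((∑ l ∈ Finset.range (2 ^ j), w (a + l)) (u a))
  have h4 := pow_le_pow_left₀ (norm_nonneg _) (h3.trans (add_le_add h2 h1)) 2
  refine h4.trans ?_
  have a1 : √(2 ^ j : ℝ) ^ 2 = 2 ^ j := Real.sq_sqrt (by positivity)
  have a2 : √(j * 2 ^ j * dyadicVar u a j) ^ 2 = j * 2 ^ j * dyadicVar u a j :=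
    Real.sq_sqrt (mul_nonneg (by positivity) (dyadicVar_nonneg u a j))
  calc _ ≤ 2 * (σ * √(2 ^ j) * U) ^ 2 + 2 * (σ * √(j * 2 ^ j * dyadicVar u a j)) ^ 2 := by
        nlinarith [sq_nonneg (σ * √(2 ^ j) * U - σ * √(j * 2 ^ j * dyadicVar u a j))]
    _ = _ := by rw [mul_pow, mul_pow, mul_pow, a1, a2]; ring

/-- The same chaining for the quadratic form: both slots move when halves are merged, hence the
factor `2 * U`. This is the energy fed into the path. -/
theorem abs_sum_inner_sub_le (hσ : 0 ≤ σ)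
    (hS : ∀ a T : ℕ, ‖∑ l ∈ Finset.range T, w (a + l)‖ ≤ σ * √T) (hU : ∀ l, ‖u l‖ ≤ U)
    (a j : ℕ) :
    |∑ l ∈ Finset.range (2 ^ j), inner ℝ (u (a + l)) (w (a + l) (u (a + l))) -
      inner ℝ (u a) ((∑ l ∈ Finset.range (2 ^ j), w (a + l)) (u a))| ≤
      2 * σ * U * √(j * 2 ^ j * dyadicVar u a j) := by
  have hU0 : 0 ≤ U := (norm_nonneg _).trans (hU 0)
  induction j generalizing a with
  | zero => simp [dyadicVar]
  | succ j ih =>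
    rw [sum_range_two_pow_succ (fun l => inner ℝ (u l) (w l (u l))), sum_range_two_pow_succ w]
    have h1 := ih a
    have h2 := ih (a + 2 ^ j)
    set S := ∑ l ∈ Finset.range (2 ^ j), w (a + 2 ^ j + l)
    have hSn : ‖S‖ ≤ σ * √(2 ^ j) := by simpa using hS (a + 2 ^ j) (2 ^ j)
    have h3 : |inner ℝ (u (a + 2 ^ j)) (S (u (a + 2 ^ j))) - inner ℝ (u a) (S (u a))| ≤
        2 * σ * U * (√(2 ^ j) * ‖u (a + 2 ^ j) - u a‖) := by
      have e : inner ℝ (u (a + 2 ^ j)) (S (u (a + 2 ^ j))) - inner ℝ (u a) (S (u a)) =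
          inner ℝ (u (a + 2 ^ j) - u a) (S (u (a + 2 ^ j))) +
            inner ℝ (u a) (S (u (a + 2 ^ j) - u a)) := by
        rw [map_sub, inner_sub_left, inner_sub_right]; ring
      have b1 : ‖S (u (a + 2 ^ j))‖ ≤ σ * √(2 ^ j) * U :=
        (S.le_opNorm _).trans (mul_le_mul hSn (hU _) (norm_nonneg _) (by positivity))
      have b2 : ‖S (u (a + 2 ^ j) - u a)‖ ≤ σ * √(2 ^ j) * ‖u (a + 2 ^ j) - u a‖ :=
        (S.le_opNorm _).trans (by gcongr)
      rw [e]
      refine (abs_add_le _ _).trans ?_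
      have c1 := (abs_real_inner_le_norm (u (a + 2 ^ j) - u a) (S (u (a + 2 ^ j)))).trans
        (mul_le_mul_of_nonneg_left b1 (norm_nonneg _))
      have c2 := (abs_real_inner_le_norm (u a) (S (u (a + 2 ^ j) - u a))).trans
        (mul_le_mul (hU a) b2 (norm_nonneg _) hU0)
      linarith
    have h4 := sqrt_dyadic_add_le j ‖u (a + 2 ^ j) - u a‖ (dyadicVar_nonneg u a j)
      (dyadicVar_nonneg u (a + 2 ^ j) j)
    rw [dyadicVar]
    refine le_trans ?_ (mul_le_mul_of_nonneg_left h4 (by positivity : 0 ≤ 2 * σ * U))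
    rw [add_apply, inner_add_right]
    have e : ∀ x y p q r : ℝ, x + y - (p + q) = (x - p) + (y - r) + (r - q) := by intros; ring
    rw [e _ _ _ _ (inner ℝ (u (a + 2 ^ j)) (S (u (a + 2 ^ j))))]
    refine (abs_add_three _ _ _).trans ?_
    rw [mul_add, mul_add]
    gcongr

end Chaining

/-! ### Maximal inequality for the increments -/

/-- The sum of the squared norms of the sums of `n` over the dyadic subintervals of
`[a, a + 2 ^ j)`: all left halves, and all single points. -/
noncomputable def dyadicEnergy (n : ℕ → EuclideanSpace ℝ ι) : ℕ → ℕ → ℝ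
  | a, 0 => ‖n a‖ ^ 2
  | a, j + 1 => ‖∑ l ∈ Finset.range (2 ^ j), n (a + l)‖ ^ 2 + dyadicEnergy n a j +
      dyadicEnergy n (a + 2 ^ j) j

/-- A Rademacher-Menshov maximal inequality: the coordinatewise maximal partial sums over a dyadic
interval are controlled by the sums over its dyadic subintervals. -/
theorem exists_maximal_bound (n : ℕ → EuclideanSpace ℝ ι) (a j : ℕ) :
    ∃ M : ι → ℝ, (∀ i, ∀ l ≤ 2 ^ j, |∑ k ∈ Finset.range l, n (a + k) i| ≤ M i) ∧
      ∑ i, M i ^ 2 ≤ (j + 1) * dyadicEnergy n a j := by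
  induction j generalizing a with
  | zero =>
    refine ⟨fun i => |n a i|, fun i l hl => ?_, ?_⟩
    · have : l = 0 ∨ l = 1 := by simp at hl; omega
      rcases this with rfl | rfl <;> simp
    · simp [dyadicEnergy, EuclideanSpace.real_norm_sq_eq]
  | succ j ih =>
    obtain ⟨M₁, h₁, e₁⟩ := ih a
    obtain ⟨M₂, h₂, e₂⟩ := ih (a + 2 ^ j)
    set N := ∑ l ∈ Finset.range (2 ^ j), n (a + l) with hN
    have hNi : ∀ i, ∑ l ∈ Finset.range (2 ^ j), n (a + l) i = N i := by
      intro i; rw [hN, WithLp.ofLp_sum, Finset.sum_apply]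
    have p₁ : ∀ i, 0 ≤ M₁ i := fun i => by simpa using h₁ i 0 (Nat.zero_le _)
    have p₂ : ∀ i, 0 ≤ M₂ i := fun i => by simpa using h₂ i 0 (Nat.zero_le _)
    refine ⟨fun i => |N i| + max (M₁ i) (M₂ i), fun i l hl => ?_, ?_⟩
    · rcases le_total l (2 ^ j) with h | h
      · exact (h₁ i l h).trans (by linarith [le_max_left (M₁ i) (M₂ i), abs_nonneg (N i)])
      · obtain ⟨l', rfl⟩ := Nat.exists_eq_add_of_le h
        rw [Finset.sum_range_add, hNi]
        refine (abs_add_le _ _).trans (add_le_add le_rfl (le_trans ?_ (le_max_right _ _)))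
        simpa [add_assoc] using h₂ i l' (by rw [pow_succ] at hl; omega)
    · have hj : (0 : ℝ) < j + 1 := by positivity
      -- Young's inequality with weights chosen so that the constant `j + 1` becomes exactly `j + 2`
      -- at the next level.
      have step : ∀ i, (|N i| + max (M₁ i) (M₂ i)) ^ 2 ≤
          (j + 2) * N i ^ 2 + (j + 2) / (j + 1) * (M₁ i ^ 2 + M₂ i ^ 2) := by
        intro i
        have hm : max (M₁ i) (M₂ i) ^ 2 ≤ M₁ i ^ 2 + M₂ i ^ 2 := by
          rcases max_choice (M₁ i) (M₂ i) with h | h <;> rw [h] <;>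
            nlinarith [sq_nonneg (M₁ i), sq_nonneg (M₂ i)]
        have hq : (|N i| + max (M₁ i) (M₂ i)) ^ 2 ≤
            (j + 2) * N i ^ 2 + (j + 2) / (j + 1) * max (M₁ i) (M₂ i) ^ 2 := by
          rw [← sq_abs (N i)]
          set x := |N i|
          set y := max (M₁ i) (M₂ i)
          have : (j + 2) * x ^ 2 + (j + 2) / (j + 1) * y ^ 2 - (x + y) ^ 2 =
              ((j + 1) * x - y) ^ 2 / (j + 1) := by
            field_simp; ring
          have h0 : 0 ≤ ((j + 1) * x - y) ^ 2 / ((j : ℝ) + 1) := by positivity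
          linarith
        refine hq.trans ?_
        gcongr
      refine (Finset.sum_le_sum fun i _ => step i).trans ?_
      rw [Finset.sum_add_distrib, ← Finset.mul_sum, ← Finset.mul_sum, Finset.sum_add_distrib,
        ← EuclideanSpace.real_norm_sq_eq, dyadicEnergy, ← hN]
      push_cast
      calc _ ≤ ((j : ℝ) + 2) * ‖N‖ ^ 2 + (j + 2) / (j + 1) *
            ((j + 1) * dyadicEnergy n a j + (j + 1) * dyadicEnergy n (a + 2 ^ j) j) := by gcongr
        _ = _ := by field_simp; ring

/-- Coordinates are reset at different times, so the scalar bound is applied to each one with its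
own maximal partial sum. This is why a coordinatewise maximal inequality is needed. -/
theorem sq_norm_sub_le_of_resets (u n δ : ℕ → EuclideanSpace ℝ ι)
    (hu : ∀ l, u (l + 1) = u l + n l - δ l) (hδ : ∀ l i, δ l i = 0 ∨ u (l + 1) i = 0)
    (a j : ℕ) :
    ‖u (a + 2 ^ j) - u a‖ ^ 2 ≤ 2 * ∑ l ∈ Finset.range (2 ^ j), ‖δ (a + l)‖ ^ 2 +
      18 * ((j + 1) * dyadicEnergy n a j) := by
  obtain ⟨M, hM, hM2⟩ := exists_maximal_bound n a j
  have h : ∀ i, (u (a + 2 ^ j) i - u a i) ^ 2 ≤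
      2 * ∑ l ∈ Finset.range (2 ^ j), δ (a + l) i ^ 2 + 18 * M i ^ 2 := fun i =>
    sq_sub_le_of_resets (fun l => u (a + l) i) (fun l => n (a + l) i) (fun l => δ (a + l) i)
      (fun l => by simp [← add_assoc, hu]) (fun l => by simpa [← add_assoc] using hδ (a + l) i)
      (M i) (2 ^ j) (hM i)
  calc ‖u (a + 2 ^ j) - u a‖ ^ 2 = ∑ i, (u (a + 2 ^ j) i - u a i) ^ 2 := by
        rw [EuclideanSpace.real_norm_sq_eq]; rfl
    _ ≤ ∑ i, (2 * ∑ l ∈ Finset.range (2 ^ j), δ (a + l) i ^ 2 + 18 * M i ^ 2) :=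
        Finset.sum_le_sum fun i _ => h i
    _ = 2 * ∑ l ∈ Finset.range (2 ^ j), ‖δ (a + l)‖ ^ 2 + 18 * ∑ i, M i ^ 2 := by
        rw [Finset.sum_add_distrib, ← Finset.mul_sum, ← Finset.mul_sum, Finset.sum_comm]
        simp_rw [EuclideanSpace.real_norm_sq_eq]
    _ ≤ _ := by gcongr

/-! ### Energy estimate for paths with resets -/

section Path

variable {u n r δ : ℕ → EuclideanSpace ℝ ι}
  {w : ℕ → EuclideanSpace ℝ ι →L[ℝ] EuclideanSpace ℝ ι} {τ σ U κ : ℝ}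

theorem sq_norm_sum_increments_le (hσ : 0 ≤ σ) (hn : ∀ l, n l = τ • w l (u l) + r l)
    (hS : ∀ a T : ℕ, ‖∑ l ∈ Finset.range T, w (a + l)‖ ≤ σ * √T) (hU : ∀ l, ‖u l‖ ≤ U)
    (hr : ∀ l, ‖r l‖ ≤ κ * U) (a j : ℕ) :
    ‖∑ l ∈ Finset.range (2 ^ j), n (a + l)‖ ^ 2 ≤
      4 * (τ ^ 2 * σ ^ 2 * 2 ^ j * (U ^ 2 + j * dyadicVar u a j)) + 2 * (κ ^ 2 * 4 ^ j * U ^ 2) := by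
  have h1 := sq_norm_sum_apply_le u w hσ hS hU a j
  have h2 : ‖∑ l ∈ Finset.range (2 ^ j), r (a + l)‖ ≤ 2 ^ j * (κ * U) := by
    refine (norm_sum_le_of_le _ fun l _ => hr (a + l)).trans_eq ?_
    simp
  have e : ∑ l ∈ Finset.range (2 ^ j), n (a + l) =
      τ • ∑ l ∈ Finset.range (2 ^ j), w (a + l) (u (a + l)) +
        ∑ l ∈ Finset.range (2 ^ j), r (a + l) := by
    simp_rw [hn, Finset.sum_add_distrib, Finset.smul_sum]
  rw [e]
  set Y := ∑ l ∈ Finset.range (2 ^ j), w (a + l) (u (a + l))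
  set R := ∑ l ∈ Finset.range (2 ^ j), r (a + l)
  have h3 := pow_le_pow_left₀ (norm_nonneg _) (norm_add_le (τ • Y) R) 2
  have h4 : ‖τ • Y‖ ^ 2 = τ ^ 2 * ‖Y‖ ^ 2 := by rw [norm_smul, mul_pow, Real.norm_eq_abs, sq_abs]
  have h5 := pow_le_pow_left₀ (norm_nonneg _) h2 2
  have h6 := mul_le_mul_of_nonneg_left h1 (sq_nonneg τ)
  have h7 : (2 ^ j * (κ * U)) ^ 2 = κ ^ 2 * 4 ^ j * U ^ 2 := by
    rw [mul_pow, ← pow_mul, mul_comm j 2, pow_mul]; norm_num; ring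
  nlinarith [sq_nonneg (‖τ • Y‖ - ‖R‖)]

/-- Each level adds one `U ^ 2`, whereas the remainder part grows like `4 ^ j` and is dominated by
the top level. The fixed `J` in front of the variation keeps its coefficient uniform through the
induction. -/
theorem dyadicEnergy_le (hσ : 0 ≤ σ) (hn : ∀ l, n l = τ • w l (u l) + r l)
    (hS : ∀ a T : ℕ, ‖∑ l ∈ Finset.range T, w (a + l)‖ ≤ σ * √T) (hU : ∀ l, ‖u l‖ ≤ U)
    (hr : ∀ l, ‖r l‖ ≤ κ * U) (J j : ℕ) (hj : j ≤ J) (a : ℕ) :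
    dyadicEnergy n a j ≤ 4 * (τ ^ 2 * σ ^ 2 * (2 ^ j * ((j + 1) * U ^ 2 + J * dyadicVar u a j))) +
      4 * (κ ^ 2 * 4 ^ j * U ^ 2) := by
  induction j generalizing a with
  | zero =>
    have h := sq_norm_sum_increments_le hσ hn hS hU hr a 0
    simp only [dyadicEnergy, dyadicVar, pow_zero, Finset.range_one, Finset.sum_singleton,
      add_zero, CharP.cast_eq_zero] at h ⊢
    nlinarith [sq_nonneg (κ * U)]
  | succ j ih =>
    have h := sq_norm_sum_increments_le hσ hn hS hU hr a j
    have h1 := ih (by omega) a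
    have h2 := ih (by omega) (a + 2 ^ j)
    rw [dyadicEnergy, dyadicVar]
    have hJ : (j : ℝ) ≤ J := by exact_mod_cast (by omega : j ≤ J)
    have n1 := dyadicVar_nonneg u a j
    have n2 := dyadicVar_nonneg u (a + 2 ^ j) j
    have nD := sq_nonneg ‖u (a + 2 ^ j) - u a‖
    set V₁ := dyadicVar u a j
    set V₂ := dyadicVar u (a + 2 ^ j) j
    set D := ‖u (a + 2 ^ j) - u a‖ ^ 2
    have c1 : (2 : ℝ) ^ j * (U ^ 2 + j * V₁) + 2 ^ j * ((j + 1) * U ^ 2 + J * V₁) +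
        2 ^ j * ((j + 1) * U ^ 2 + J * V₂) ≤
        2 ^ (j + 1) * (((j + 1 : ℕ) + 1) * U ^ 2 + J * (D + V₁ + V₂)) := by
      rw [pow_succ (2 : ℝ), mul_assoc (2 ^ j), ← mul_add, ← mul_add]
      refine mul_le_mul_of_nonneg_left ?_ (by positivity)
      push_cast
      nlinarith [mul_le_mul_of_nonneg_right hJ n1, mul_nonneg (Nat.cast_nonneg (α := ℝ) J) nD,
        mul_nonneg (Nat.cast_nonneg (α := ℝ) J) n2, sq_nonneg U]
    have c2 := mul_le_mul_of_nonneg_left c1 (by positivity : 0 ≤ τ ^ 2 * σ ^ 2)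
    have c3 : 0 ≤ κ ^ 2 * 4 ^ j * U ^ 2 := by positivity
    have c4 : κ ^ 2 * 4 ^ (j + 1) * U ^ 2 = 4 * (κ ^ 2 * 4 ^ j * U ^ 2) := by ring
    rw [c4]
    nlinarith

/-- The variation occurs on both sides on purpose: the increments are themselves estimated by
chaining. For small `τ σ √(2 ^ J) J` the right-hand occurrence can be absorbed. -/
theorem dyadicVar_le (hσ : 0 ≤ σ) (hn : ∀ l, n l = τ • w l (u l) + r l)
    (hS : ∀ a T : ℕ, ‖∑ l ∈ Finset.range T, w (a + l)‖ ≤ σ * √T) (hU : ∀ l, ‖u l‖ ≤ U)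
    (hr : ∀ l, ‖r l‖ ≤ κ * U) (hu : ∀ l, u (l + 1) = u l + n l - δ l)
    (hδ : ∀ l i, δ l i = 0 ∨ u (l + 1) i = 0) (J j : ℕ) (hj : j ≤ J) (a : ℕ) :
    dyadicVar u a j ≤ 2 * j * ∑ l ∈ Finset.range (2 ^ j), ‖δ (a + l)‖ ^ 2 +
      72 * J * (τ ^ 2 * σ ^ 2 * (2 ^ j * (j * J * U ^ 2 + J * dyadicVar u a j)) +
        κ ^ 2 * 4 ^ j * U ^ 2) := by
  induction j generalizing a with
  | zero =>
    have : 0 ≤ ∑ l ∈ Finset.range (2 ^ 0), ‖δ (a + l)‖ ^ 2 := Finset.sum_nonneg fun _ _ => sq_nonneg _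
    simp only [dyadicVar]
    positivity
  | succ j ih =>
    have h := sq_norm_sub_le_of_resets u n δ hu hδ a j
    have h0 := dyadicEnergy_le hσ hn hS hU hr J j (by omega) a
    have h1 := ih (by omega) a
    have h2 := ih (by omega) (a + 2 ^ j)
    rw [sum_range_two_pow_succ (fun l => ‖δ l‖ ^ 2), dyadicVar]
    have hJ : (j + 1 : ℝ) ≤ J := by exact_mod_cast hj
    have n1 := dyadicVar_nonneg u a j
    have n2 := dyadicVar_nonneg u (a + 2 ^ j) j
    have nD := sq_nonneg ‖u (a + 2 ^ j) - u a‖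
    set V₁ := dyadicVar u a j
    set V₂ := dyadicVar u (a + 2 ^ j) j
    set D := ‖u (a + 2 ^ j) - u a‖ ^ 2
    have k1 : 0 ≤ ∑ l ∈ Finset.range (2 ^ j), ‖δ (a + l)‖ ^ 2 :=
      Finset.sum_nonneg fun _ _ => sq_nonneg _
    have k2 : 0 ≤ ∑ l ∈ Finset.range (2 ^ j), ‖δ (a + 2 ^ j + l)‖ ^ 2 :=
      Finset.sum_nonneg fun _ _ => sq_nonneg _
    set K₁ := ∑ l ∈ Finset.range (2 ^ j), ‖δ (a + l)‖ ^ 2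
    set K₂ := ∑ l ∈ Finset.range (2 ^ j), ‖δ (a + 2 ^ j + l)‖ ^ 2
    have hJ0 : (0 : ℝ) ≤ J := Nat.cast_nonneg _
    have hj0 : (0 : ℝ) ≤ j := Nat.cast_nonneg _
    have e0 : (j + 1) * dyadicEnergy n a j ≤ J * (4 * (τ ^ 2 * σ ^ 2 * (2 ^ j * (J * U ^ 2 + J * V₁))) +
      4 * (κ ^ 2 * 4 ^ j * U ^ 2)) := by
      calc _ ≤ (j + 1) * (4 * (τ ^ 2 * σ ^ 2 * (2 ^ j * ((j + 1) * U ^ 2 + J * V₁))) +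
            4 * (κ ^ 2 * 4 ^ j * U ^ 2)) := by gcongr
        _ ≤ _ := by gcongr
    have c1 : (2 : ℝ) ^ j * (J * U ^ 2 + J * V₁) + 2 ^ j * (j * J * U ^ 2 + J * V₁) +
        2 ^ j * (j * J * U ^ 2 + J * V₂) ≤
        2 ^ (j + 1) * ((j + 1 : ℕ) * J * U ^ 2 + J * (D + V₁ + V₂)) := by
      rw [pow_succ (2 : ℝ), mul_assoc (2 ^ j), ← mul_add, ← mul_add]
      refine mul_le_mul_of_nonneg_left ?_ (by positivity)
      push_cast
      nlinarith [mul_nonneg hJ0 nD, mul_nonneg hJ0 n2, mul_nonneg hJ0 (sq_nonneg U)]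
    have c2 := mul_le_mul_of_nonneg_left c1 (by positivity : 0 ≤ τ ^ 2 * σ ^ 2)
    have c3 : 0 ≤ κ ^ 2 * 4 ^ j * U ^ 2 := by positivity
    have c4 : κ ^ 2 * 4 ^ (j + 1) * U ^ 2 = 4 * (κ ^ 2 * 4 ^ j * U ^ 2) := by ring
    rw [c4]
    set Q := κ ^ 2 * 4 ^ j * U ^ 2
    have c5 : τ ^ 2 * σ ^ 2 * (2 ^ j * (J * U ^ 2 + J * V₁)) + Q +
        (τ ^ 2 * σ ^ 2 * (2 ^ j * (j * J * U ^ 2 + J * V₁)) + Q) +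
        (τ ^ 2 * σ ^ 2 * (2 ^ j * (j * J * U ^ 2 + J * V₂)) + Q) ≤
        τ ^ 2 * σ ^ 2 * (2 ^ (j + 1) * ((j + 1 : ℕ) * J * U ^ 2 + J * (D + V₁ + V₂))) + 4 * Q := by
      linarith
    have c6 := mul_le_mul_of_nonneg_left c5 (by positivity : 0 ≤ 72 * (J : ℝ))
    have c7 : 2 * K₁ + 2 * j * K₁ + 2 * j * K₂ ≤ 2 * (j + 1 : ℕ) * (K₁ + K₂) := by
      push_cast; nlinarith
    linarith

/-- The energy estimate for paths with resets driven by operators whose sums over intervals show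
square-root cancellation. -/
theorem sq_norm_endpoint_le (hσ : 1 ≤ σ) (hτ : 0 ≤ τ) (hκ : 0 ≤ κ)
    (hn : ∀ l, n l = τ • w l (u l) + r l)
    (hS : ∀ a T : ℕ, ‖∑ l ∈ Finset.range T, w (a + l)‖ ≤ σ * √T) (hU : ∀ l, ‖u l‖ ≤ U)
    (hr : ∀ l, ‖r l‖ ≤ κ * U) (hu : ∀ l, u (l + 1) = u l + n l - δ l)
    (hδ : ∀ l i, δ l i = 0 ∨ u (l + 1) i = 0)
    (hE : ∀ l, ‖u l + n l‖ ^ 2 ≤ ‖u l‖ ^ 2 + 2 * τ * inner ℝ (u l) (w l (u l)) +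
      σ ^ 2 * τ ^ 2 * ‖u l‖ ^ 2)
    (J : ℕ) (hJ : 1 ≤ J) (hκJ : κ * 2 ^ J ≤ 6) (hε : σ * (τ * √(2 ^ J) * J) ≤ 1 / 30000) :
    ‖u (2 ^ J)‖ ^ 2 ≤ ‖u 0‖ ^ 2 + U ^ 2 / 2 := by
  have hU0 : 0 ≤ U := (norm_nonneg _).trans (hU 0)
  have hσ0 : 0 ≤ σ := by linarith
  have hJ1 : (1 : ℝ) ≤ J := by exact_mod_cast hJ
  set s := √(2 ^ J : ℝ) with hs
  have hs2 : s ^ 2 = 2 ^ J := Real.sq_sqrt (by positivity)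
  have hs0 : 0 ≤ s := Real.sqrt_nonneg _
  set K := ∑ l ∈ Finset.range (2 ^ J), ‖δ l‖ ^ 2 with hK
  have hK0 : 0 ≤ K := Finset.sum_nonneg fun _ _ => sq_nonneg _
  set V := dyadicVar u 0 J with hVdef
  have hV0 : 0 ≤ V := dyadicVar_nonneg u 0 J
  set e := σ * (τ * s * J) with he
  have he0 : 0 ≤ e := by positivity
  -- The variation on the right has coefficient `72 e²`, far below `1/2`. Absorbing it at most
  -- doubles the other constants; `5185` is `2 * 72 * 36` plus room for the small `e²` term.
  have hV : V ≤ J * (4 * K + 5185 * U ^ 2) := by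
    have h := dyadicVar_le hσ0 hn hS hU hr hu hδ J J le_rfl 0
    simp only [zero_add] at h
    rw [← hK, ← hVdef] at h
    have hsq : e ^ 2 ≤ 1 / 900000000 := by
      have := pow_le_pow_left₀ he0 hε 2
      norm_num at this ⊢; exact this
    have e1 : τ ^ 2 * σ ^ 2 * (2 ^ J * (J * J * U ^ 2 + J * V)) * J = e ^ 2 * (J * U ^ 2 + V) := by
      rw [he, ← hs2]; ring
    have e2 : κ ^ 2 * 4 ^ J * U ^ 2 ≤ 36 * U ^ 2 := by
      have := pow_le_pow_left₀ (by positivity) hκJ 2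
      rw [mul_pow, ← pow_mul, mul_comm J 2, pow_mul] at this
      norm_num at this
      gcongr
    have e3 : e ^ 2 * (J * U ^ 2 + V) ≤ 1 / 900000000 * (J * U ^ 2 + V) := by gcongr
    have e4 : J * (κ ^ 2 * 4 ^ J * U ^ 2) ≤ J * (36 * U ^ 2) := by gcongr
    have e5 : 0 ≤ J * U ^ 2 := by positivity
    nlinarith
  have hG := abs_sum_inner_sub_le u w hσ0 hS hU 0 J
  simp only [zero_add] at hG
  set G := ∑ l ∈ Finset.range (2 ^ J), inner ℝ (u l) (w l (u l)) with hGdef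
  -- Pythagoras: `u (l + 1)` and `δ l` have disjoint supports, so each jump dissipates its full
  -- squared norm.
  have hE' : ∀ l, ‖u (l + 1)‖ ^ 2 + ‖δ l‖ ^ 2 = ‖u l + n l‖ ^ 2 := by
    intro l
    simp_rw [EuclideanSpace.real_norm_sq_eq]
    rw [← Finset.sum_add_distrib]
    refine Finset.sum_congr rfl fun i _ => ?_
    have h : (u l + n l) i = u (l + 1) i + δ l i := by rw [hu]; simp
    rw [h]
    rcases hδ l i with h0 | h0 <;> rw [h0] <;> ring
  have hsum : ∀ T, ‖u T‖ ^ 2 + ∑ l ∈ Finset.range T, ‖δ l‖ ^ 2 ≤ ‖u 0‖ ^ 2 +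
      2 * τ * ∑ l ∈ Finset.range T, inner ℝ (u l) (w l (u l)) + T * (σ ^ 2 * τ ^ 2 * U ^ 2) := by
    intro T
    induction T with
    | zero => simp
    | succ T ih =>
      rw [Finset.sum_range_succ, Finset.sum_range_succ]
      push_cast
      have h1 := hE T
      have h2 := hE' T
      have h3 : σ ^ 2 * τ ^ 2 * ‖u T‖ ^ 2 ≤ σ ^ 2 * τ ^ 2 * U ^ 2 := by
        gcongr; exact hU T
      linarith
  have hfin := hsum (2 ^ J)
  rw [← hK, ← hGdef] at hfin
  push_cast at hfin
  have hts : σ * (τ * s) ≤ e := by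
    rw [he]
    exact mul_le_mul_of_nonneg_left (le_mul_of_one_le_right (by positivity) hJ1) hσ0
  have g1 : |inner ℝ (u 0) ((∑ l ∈ Finset.range (2 ^ J), w l) (u 0))| ≤ σ * s * U ^ 2 := by
    refine (abs_real_inner_le_norm _ _).trans ?_
    have h1 : ‖(∑ l ∈ Finset.range (2 ^ J), w l) (u 0)‖ ≤ σ * s * U := by
      refine (ContinuousLinearMap.le_opNorm _ _).trans ?_
      refine mul_le_mul ?_ (hU 0) (norm_nonneg _) (by positivity)
      simpa using hS 0 (2 ^ J)
    calc _ ≤ U * (σ * s * U) := mul_le_mul (hU 0) h1 (norm_nonneg _) hU0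
      _ = _ := by ring
  have g2 : √(J * 2 ^ J * V) ≤ s * J * √(4 * K + 5185 * U ^ 2) := by
    apply Real.sqrt_le_iff.2 ⟨by positivity, ?_⟩
    rw [mul_pow, mul_pow, hs2, Real.sq_sqrt (by positivity)]
    calc _ ≤ J * 2 ^ J * (J * (4 * K + 5185 * U ^ 2)) := by gcongr
      _ = _ := by ring
  set X := √(4 * K + 5185 * U ^ 2)
  have hX : X ^ 2 = 4 * K + 5185 * U ^ 2 := Real.sq_sqrt (by positivity)
  have g3 : 2 * τ * G ≤ 2 * e * U ^ 2 + 4 * e * (U * X) := by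
    have h1 : G ≤ σ * s * U ^ 2 + 2 * σ * U * (s * J * X) := by
      have h2 := le_abs_self (inner ℝ (u 0) ((∑ l ∈ Finset.range (2 ^ J), w l) (u 0)))
      have h3 := (le_abs_self _).trans hG
      have h4 := mul_le_mul_of_nonneg_left g2 (by positivity : 0 ≤ 2 * σ * U)
      linarith
    have h2 := mul_le_mul_of_nonneg_left h1 (by positivity : 0 ≤ 2 * τ)
    have h3 := mul_le_mul_of_nonneg_right hts (sq_nonneg U)
    have h4 : 2 * τ * (2 * σ * U * (s * J * X)) = 4 * e * (U * X) := by rw [he]; ring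
    linarith
  have g4 : 4 * e * (U * X) ≤ 2 * e * (5186 * U ^ 2 + 4 * K) := by
    have : 2 * (U * X) ≤ U ^ 2 + X ^ 2 := by nlinarith [sq_nonneg (U - X)]
    rw [hX] at this
    nlinarith
  have g5 : 2 ^ J * (σ ^ 2 * τ ^ 2 * U ^ 2) ≤ e * U ^ 2 := by
    have h1 : 2 ^ J * (σ ^ 2 * τ ^ 2 * U ^ 2) = (σ * (τ * s)) ^ 2 * U ^ 2 := by rw [← hs2]; ring
    rw [h1]
    refine mul_le_mul_of_nonneg_right ?_ (sq_nonneg U)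
    nlinarith [mul_nonneg hσ0 (mul_nonneg hτ hs0)]
  -- The terms in `U ^ 2` add up to `10375 e ≤ 1/2` and those in `K` to `8 e ≤ 1`, so the threshold
  -- `1 / 30000` suffices and `K` is absorbed by the dissipation.
  have g6 : e * U ^ 2 ≤ 1 / 30000 * U ^ 2 := by gcongr
  have g7 : e * K ≤ 1 / 30000 * K := by gcongr
  linarith [sq_nonneg U]

/-- Paths with resets stay bounded: finite horizon version. -/
theorem sq_norm_le_of_path (N : ℕ) (hσ : 1 ≤ σ) (hτ : 0 ≤ τ) (hκ : 0 ≤ κ)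
    (hS : ∀ a T : ℕ, a + T ≤ N → ‖∑ l ∈ Finset.range T, w (a + l)‖ ≤ σ * √T)
    (hr : ∀ l < N, ‖r l‖ ≤ κ * ‖u l‖)
    (hu : ∀ l < N, ∀ i, u (l + 1) i = (u l + (τ • w l (u l) + r l)) i ∨ u (l + 1) i = 0)
    (hE : ∀ l < N, ‖u l + (τ • w l (u l) + r l)‖ ^ 2 ≤ ‖u l‖ ^ 2 +
      2 * τ * inner ℝ (u l) (w l (u l)) + σ ^ 2 * τ ^ 2 * ‖u l‖ ^ 2)
    (J : ℕ) (hJ : 1 ≤ J) (hNJ : N ≤ 2 ^ J) (hκJ : κ * 2 ^ J ≤ 6)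
    (hε : σ * (τ * √(2 ^ J) * J) ≤ 1 / 30000) (l : ℕ) (hl : l ≤ N) :
    ‖u l‖ ^ 2 ≤ 2 * ‖u 0‖ ^ 2 := by
  -- The path is frozen from the time `q` of its largest norm on. Its endpoint at `2 ^ J` then
  -- realizes the a priori bound `U`, and `U² ≤ ‖u 0‖² + U² / 2` gives the claim.
  obtain ⟨q, hq, hmax⟩ := Finset.exists_max_image (Finset.range (N + 1)) (fun l => ‖u l‖)
    ⟨0, by simp⟩
  have hqN : q ≤ N := by simpa [Nat.lt_succ_iff] using hq
  have hmax' : ∀ l ≤ N, ‖u l‖ ≤ ‖u q‖ := fun l hl => hmax l (by simpa [Nat.lt_succ_iff] using hl)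
  have key := sq_norm_endpoint_le (u := fun l => u (min l q)) (w := fun l => if l < q then w l else 0)
    (r := fun l => if l < q then r l else 0)
    (n := fun l => τ • (if l < q then w l else 0) (u (min l q)) + if l < q then r l else 0)
    (δ := fun l => u (min l q) + (τ • (if l < q then w l else 0) (u (min l q)) +
      if l < q then r l else 0) - u (min (l + 1) q)) (U := ‖u q‖) hσ hτ hκ (fun l => rfl) ?_
    (fun l => hmax' _ ((min_le_right _ _).trans hqN)) ?_ (fun l => by abel) ?_ ?_ J hJ hκJ hε
  · simp only [min_eq_right (hqN.trans hNJ), Nat.zero_min] at key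
    have := pow_le_pow_left₀ (norm_nonneg _) (hmax' l hl) 2
    linarith
  · intro a T
    have h0 : ∀ T, ∑ l ∈ Finset.range T, (if a + l < q then w (a + l) else 0) =
        ∑ l ∈ Finset.range (min T (q - a)), w (a + l) := by
      intro T
      rw [← Finset.sum_filter]
      congr 1
      ext k
      simp
      omega
    rw [h0]
    rcases le_total a q with h | h
    · refine (hS a _ (by omega)).trans ?_
      gcongr
      exact min_le_left _ _
    · rw [Nat.sub_eq_zero_of_le h]
      simp; positivity
  · intro l
    split_ifs with h
    · refine (hr l (by omega)).trans ?_
      gcongr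
      exact hmax' l (by omega)
    · simp; positivity
  · intro l i
    by_cases h : l < q
    · rw [if_pos h, if_pos h, min_eq_left h.le, min_eq_left (by omega : l + 1 ≤ q)]
      rcases hu l (by omega) i with h1 | h1
      · left
        rw [PiLp.sub_apply, h1, sub_self]
      · exact Or.inr h1
    · left
      rw [if_neg h, if_neg h, min_eq_right (by omega), min_eq_right (by omega)]
      simp
  · intro l
    by_cases h : l < q
    · rw [if_pos h, if_pos h, min_eq_left h.le]
      exact hE l (by omega)
    · rw [if_neg h, if_neg h]
      simp; positivity

end Path

/-! ### Exponential moments of operator norms -/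

theorem exists_inner_apply_ge {E F : Type*} [NormedAddCommGroup E] [InnerProductSpace ℝ E]
    [NormedAddCommGroup F] [InnerProductSpace ℝ F] (G : E →L[ℝ] F) :
    ∃ (x : E) (y : F), ‖x‖ ≤ 1 ∧ ‖y‖ ≤ 1 ∧ 7 / 8 * ‖G‖ ≤ inner ℝ y (G x) := by
  rcases (norm_nonneg G).eq_or_lt with h | h
  · exact ⟨0, 0, by simp, by simp, by simp [← h]⟩
  · obtain ⟨x, hx, hG⟩ := G.exists_lt_apply_of_lt_opNorm (r := 7 / 8 * ‖G‖) (by linarith)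
    have h0 : 0 < ‖G x‖ := lt_trans (by positivity) hG
    refine ⟨x, ‖G x‖⁻¹ • G x, hx.le, ?_, ?_⟩
    · rw [norm_smul, norm_inv, norm_norm, inv_mul_cancel₀ h0.ne']
    · rw [real_inner_smul_left, real_inner_self_eq_norm_sq]
      field_simp
      linarith

section OperatorNormTail

variable {E F : Type*} [NormedAddCommGroup E] [InnerProductSpace ℝ E] [FiniteDimensional ℝ E]
  [MeasurableSpace E] [BorelSpace E] [NormedAddCommGroup F] [InnerProductSpace ℝ F]
  [FiniteDimensional ℝ F] [MeasurableSpace F] [BorelSpace F]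

/-- The operator norm is controlled by the average of the exponential of the bilinear form over a
product of balls. -/
theorem exp_opNorm_mul_measure_le (μ : Measure E) [μ.IsAddHaarMeasure] (ν : Measure F)
    [ν.IsAddHaarMeasure] (G : E →L[ℝ] F) {t : ℝ} (ht : 0 ≤ t) :
    ENNReal.ofReal (Real.exp (5 / 16 * t * ‖G‖)) *
      (μ (Metric.ball 0 (1 / 4)) * ν (Metric.ball 0 (1 / 4))) ≤
    ∫⁻ z in Metric.ball 0 (5 / 4) ×ˢ Metric.ball 0 (5 / 4),
      ENNReal.ofReal (Real.exp (t * inner ℝ z.2 (G z.1))) ∂(μ.prod ν) := by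
  obtain ⟨x₀, y₀, hx₀, hy₀, hxy⟩ := exists_inner_apply_ge G
  have hsub : Metric.ball x₀ (1 / 4) ×ˢ Metric.ball y₀ (1 / 4) ⊆
      Metric.ball (0 : E) (5 / 4) ×ˢ Metric.ball (0 : F) (5 / 4) :=
    Set.prod_mono (Metric.ball_subset_ball' (by rw [dist_zero_right]; linarith))
      (Metric.ball_subset_ball' (by rw [dist_zero_right]; linarith))
  have hm : (μ (Metric.ball 0 (1 / 4)) * ν (Metric.ball 0 (1 / 4))) =
      (μ.prod ν) (Metric.ball x₀ (1 / 4) ×ˢ Metric.ball y₀ (1 / 4)) := by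
    rw [Measure.prod_prod, Measure.addHaar_ball_center μ x₀, Measure.addHaar_ball_center ν y₀]
  rw [hm, ← setLIntegral_const]
  refine le_trans ?_ (lintegral_mono_set hsub)
  refine setLIntegral_mono' (measurableSet_ball.prod measurableSet_ball) fun z hz => ?_
  obtain ⟨hz1, hz2⟩ := hz
  rw [Metric.mem_ball, dist_eq_norm] at hz1 hz2
  apply ENNReal.ofReal_le_ofReal
  apply Real.exp_le_exp.2
  have e : inner ℝ z.2 (G z.1) = inner ℝ y₀ (G x₀) + inner ℝ (z.2 - y₀) (G z.1) +
      inner ℝ y₀ (G (z.1 - x₀)) := by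
    rw [map_sub, inner_sub_left, inner_sub_right]; ring
  have n1 : ‖z.1‖ ≤ 5 / 4 := by
    have := norm_le_norm_add_norm_sub' z.1 x₀
    linarith
  have b1 := (abs_real_inner_le_norm (z.2 - y₀) (G z.1)).trans (mul_le_mul hz2.le
    ((G.le_opNorm _).trans (mul_le_mul_of_nonneg_left n1 (norm_nonneg G))) (norm_nonneg _)
    (by norm_num))
  have b2 := (abs_real_inner_le_norm y₀ (G (z.1 - x₀))).trans (mul_le_mul hy₀
    ((G.le_opNorm _).trans (mul_le_mul_of_nonneg_left hz1.le (norm_nonneg G))) (norm_nonneg _)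
    (by norm_num))
  -- `5/16 = 7/8 - (1/4)(5/4) - 1/4`: moving both near-maximizers by `1/4` keeps a fixed share of
  -- the norm.
  have : 5 / 16 * ‖G‖ ≤ inner ℝ z.2 (G z.1) := by
    rw [e]
    linarith [neg_abs_le (inner ℝ (z.2 - y₀) (G z.1)), neg_abs_le (inner ℝ y₀ (G (z.1 - x₀)))]
  calc _ = t * (5 / 16 * ‖G‖) := by ring
    _ ≤ _ := by gcongr

variable {Ω : Type*} [MeasurableSpace Ω] [TopologicalSpace Ω] [SecondCountableTopology Ω]
  [OpensMeasurableSpace Ω] (μ : Measure Ω) [IsProbabilityMeasure μ]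

/-- An integrated form of the net argument: Fubini puts the expectation inside the average over the
two balls, where the bilinear form is subgaussian. The ratio of the radii `5/4` and `1/4` gives the
factor `5` per dimension. -/
theorem lintegral_exp_opNorm_le {G : Ω → E →L[ℝ] F} (hG : Continuous G) {s t : ℝ} (hs : 0 ≤ s)
    (ht : 0 ≤ t)
    (h : ∀ x y, ∫⁻ ω, ENNReal.ofReal (Real.exp (inner ℝ y (G ω x))) ∂μ ≤
      ENNReal.ofReal (Real.exp (s * (‖x‖ ^ 2 * ‖y‖ ^ 2) / 2))) :
    ∫⁻ ω, ENNReal.ofReal (Real.exp (5 / 16 * t * ‖G ω‖)) ∂μ ≤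
      ENNReal.ofReal (5 ^ (Module.finrank ℝ E + Module.finrank ℝ F) *
        Real.exp (2 * (s * t ^ 2))) := by
  let α : Measure E := Measure.addHaar
  let β : Measure F := Measure.addHaar
  set c := α (Metric.ball 0 (1 / 4)) * β (Metric.ball 0 (1 / 4)) with hc
  have hc0 : c ≠ 0 := mul_ne_zero (Metric.measure_ball_pos α _ (by norm_num)).ne'
    (Metric.measure_ball_pos β _ (by norm_num)).ne'
  have hct : c ≠ ⊤ := ENNReal.mul_ne_top measure_ball_lt_top.ne measure_ball_lt_top.ne
  have hbig : α (Metric.ball 0 (5 / 4)) * β (Metric.ball 0 (5 / 4)) =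
      ENNReal.ofReal (5 ^ (Module.finrank ℝ E + Module.finrank ℝ F)) * c := by
    rw [hc, Measure.addHaar_ball_of_pos α _ (by norm_num : (0 : ℝ) < 5 / 4),
      Measure.addHaar_ball_of_pos β _ (by norm_num : (0 : ℝ) < 5 / 4),
      Measure.addHaar_ball_of_pos α _ (by norm_num : (0 : ℝ) < 1 / 4),
      Measure.addHaar_ball_of_pos β _ (by norm_num : (0 : ℝ) < 1 / 4), pow_add,
      ENNReal.ofReal_mul (by positivity), show (5 / 4 : ℝ) = 5 * (1 / 4) by norm_num, mul_pow,
      mul_pow, ENNReal.ofReal_mul (by positivity), ENNReal.ofReal_mul (by positivity)]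
    ring
  rw [← ENNReal.mul_le_mul_iff_left hc0 hct, ← lintegral_mul_const' _ _ hct]
  calc _ ≤ ∫⁻ ω, ∫⁻ z in Metric.ball 0 (5 / 4) ×ˢ Metric.ball 0 (5 / 4),
        ENNReal.ofReal (Real.exp (t * inner ℝ z.2 (G ω z.1))) ∂(α.prod β) ∂μ :=
        lintegral_mono fun ω => exp_opNorm_mul_measure_le α β (G ω) ht
    _ = ∫⁻ z in Metric.ball 0 (5 / 4) ×ˢ Metric.ball 0 (5 / 4), ∫⁻ ω,
        ENNReal.ofReal (Real.exp (t * inner ℝ z.2 (G ω z.1))) ∂μ ∂(α.prod β) := by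
        apply lintegral_lintegral_swap
        refine Measurable.aemeasurable (Continuous.measurable ?_)
        simp only [Function.uncurry_def]
        exact ENNReal.continuous_ofReal.comp (by fun_prop)
    _ ≤ ∫⁻ z in Metric.ball (0 : E) (5 / 4) ×ˢ Metric.ball (0 : F) (5 / 4),
        ENNReal.ofReal (Real.exp (2 * (s * t ^ 2))) ∂(α.prod β) := by
        refine setLIntegral_mono' (measurableSet_ball.prod measurableSet_ball) fun z hz => ?_
        obtain ⟨hz1, hz2⟩ := hz
        rw [Metric.mem_ball, dist_zero_right] at hz1 hz2
        have h1 := h z.1 (t • z.2)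
        simp only [real_inner_smul_left] at h1
        refine h1.trans (ENNReal.ofReal_le_ofReal (Real.exp_le_exp.2 ?_))
        rw [norm_smul, mul_pow, Real.norm_eq_abs, sq_abs]
        have a1 : ‖z.1‖ ^ 2 * ‖z.2‖ ^ 2 ≤ (5 / 4) ^ 2 * (5 / 4) ^ 2 := by gcongr
        have a2 := mul_le_mul_of_nonneg_left a1 (by positivity : 0 ≤ s * t ^ 2)
        nlinarith [mul_nonneg hs (sq_nonneg t)]
    _ = ENNReal.ofReal (Real.exp (2 * (s * t ^ 2))) *
        (α (Metric.ball 0 (5 / 4)) * β (Metric.ball 0 (5 / 4))) := by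
        rw [setLIntegral_const, Measure.prod_prod]
    _ = _ := by
        rw [hbig, ENNReal.ofReal_mul (by positivity)]; ring

theorem five_pow_mul_exp_le {N m : ℕ} (hN : N ≤ 2 * m) {q : ℝ} (hq : q ≤ 2 * m) :
    5 ^ N * Real.exp (2 * q) ≤ Real.exp (8 * m) := by
  have h5 : (5 : ℝ) ≤ Real.exp 2 := by
    have h := Real.add_one_le_exp (1 : ℝ)
    have h' := Real.exp_one_gt_d9
    rw [show (2 : ℝ) = 1 + 1 by norm_num, Real.exp_add]
    nlinarith
  calc (5 : ℝ) ^ N * Real.exp (2 * q) ≤ Real.exp 2 ^ (2 * m) * Real.exp (4 * m) := by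
        refine mul_le_mul ?_ (Real.exp_le_exp.2 (by linarith)) (Real.exp_pos _).le (by positivity)
        calc (5 : ℝ) ^ N ≤ 5 ^ (2 * m) := pow_le_pow_right₀ (by norm_num) hN
          _ ≤ _ := by gcongr
    _ = Real.exp (8 * m) := by
        rw [← Real.exp_nat_mul, ← Real.exp_add]; push_cast; ring_nf

theorem measure_opNorm_gt_le {G : Ω → E →L[ℝ] F} (hG : Continuous G) {s t : ℝ} (hs : 0 ≤ s)
    (ht : 0 < t)
    (h : ∀ x y, ∫⁻ ω, ENNReal.ofReal (Real.exp (inner ℝ y (G ω x))) ∂μ ≤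
      ENNReal.ofReal (Real.exp (s * (‖x‖ ^ 2 * ‖y‖ ^ 2) / 2)))
    (m : ℕ) (hdim : Module.finrank ℝ E + Module.finrank ℝ F ≤ 2 * m) (hst : s * t ^ 2 ≤ 2 * m) :
    μ {ω | 64 * m / t < ‖G ω‖} ≤ ENNReal.ofReal (Real.exp (-(12 * m))) := by
  have h1 := lintegral_exp_opNorm_le μ hG hs ht.le h
  have hmeas : Measurable fun ω => ENNReal.ofReal (Real.exp (5 / 16 * t * ‖G ω‖)) :=
    (ENNReal.continuous_ofReal.comp (by fun_prop)).measurable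
  have h2 := mul_meas_ge_le_lintegral (μ := μ) hmeas (ENNReal.ofReal (Real.exp (20 * m)))
  -- Chernoff: at the threshold the exponent is `5/16 * 64 m = 20 m`, against a moment of at most
  -- `exp (8 m)`.
  have h3 : μ {ω | 64 * m / t < ‖G ω‖} ≤ μ {ω | ENNReal.ofReal (Real.exp (20 * m)) ≤
      ENNReal.ofReal (Real.exp (5 / 16 * t * ‖G ω‖))} := by
    refine measure_mono fun ω hω => ENNReal.ofReal_le_ofReal (Real.exp_le_exp.2 ?_)
    replace hω : 64 * m / t < ‖G ω‖ := hω
    rw [div_lt_iff₀ ht] at hω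
    linarith
  have h4 : ENNReal.ofReal (Real.exp (20 * m)) * μ {ω | 64 * m / t < ‖G ω‖} ≤
      ENNReal.ofReal (Real.exp (20 * m)) * ENNReal.ofReal (Real.exp (-(12 * m))) := by
    rw [← ENNReal.ofReal_mul (Real.exp_pos _).le, ← Real.exp_add]
    refine ((mul_le_mul_right h3 _).trans h2).trans (h1.trans (ENNReal.ofReal_le_ofReal ?_))
    refine (five_pow_mul_exp_le hdim hst).trans_eq ?_
    ring_nf
  rwa [ENNReal.mul_le_mul_iff_right (by simp [Real.exp_pos]) ENNReal.ofReal_ne_top] at h4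

end OperatorNormTail

/-! ### Gaussian moment generating functions -/

section GaussianMGF

theorem lintegral_exp_mul_gaussianReal (v : ℝ≥0) (c : ℝ) :
    ∫⁻ x, ENNReal.ofReal (Real.exp (c * x)) ∂(gaussianReal 0 v) =
      ENNReal.ofReal (Real.exp (v * c ^ 2 / 2)) := by
  rw [← ofReal_integral_eq_lintegral_ofReal (integrable_exp_mul_gaussianReal c)
    (Filter.Eventually.of_forall fun x => (Real.exp_pos _).le)]
  have := congrFun (mgf_id_gaussianReal (μ := 0) (v := v)) c
  simp only [mgf, id, zero_mul, zero_add] at this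
  rw [this]

theorem lintegral_exp_sum_pi {ι : Type*} [Fintype ι] {X : ι → Type*}
    [∀ i, MeasurableSpace (X i)] (μ : ∀ i, Measure (X i)) [∀ i, IsProbabilityMeasure (μ i)]
    (f : ∀ i, X i → ℝ) (hf : ∀ i, Measurable (f i)) (v : ι → ℝ)
    (h : ∀ i, ∫⁻ x, ENNReal.ofReal (Real.exp (f i x)) ∂(μ i) = ENNReal.ofReal (Real.exp (v i))) :
    ∫⁻ θ, ENNReal.ofReal (Real.exp (∑ i, f i (θ i))) ∂(Measure.pi μ) =
      ENNReal.ofReal (Real.exp (∑ i, v i)) := by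
  have hint : ∀ i, Integrable (fun x => Real.exp (f i x)) (μ i) := fun i => by
    refine ⟨(hf i).exp.aestronglyMeasurable, ?_⟩
    rw [hasFiniteIntegral_iff_ofReal (Filter.Eventually.of_forall fun x => (Real.exp_pos _).le), h]
    exact ENNReal.ofReal_lt_top
  have hval : ∀ i, ∫ x, Real.exp (f i x) ∂(μ i) = Real.exp (v i) := fun i => by
    rw [integral_eq_lintegral_of_nonneg_ae
      (Filter.Eventually.of_forall fun x => (Real.exp_pos _).le) (hint i).1, h,
      ENNReal.toReal_ofReal (Real.exp_pos _).le]
  simp_rw [Real.exp_sum]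
  rw [← ofReal_integral_eq_lintegral_ofReal,
    integral_fintype_prod_eq_prod (fun i x => Real.exp (f i x))]
  · simp_rw [hval]
  · exact Integrable.fintype_prod_dep hint
  · exact Filter.Eventually.of_forall fun x => Finset.prod_nonneg fun i _ => (Real.exp_pos _).le

theorem lintegral_exp_matrix_gaussian (a b : ℕ) (v : ℝ≥0) (c : Fin a → Fin b → ℝ) :
    ∫⁻ M : Fin a → Fin b → ℝ, ENNReal.ofReal (Real.exp (∑ i, ∑ j, c i j * M i j))
        ∂(Measure.pi fun _ => Measure.pi fun _ => gaussianReal 0 v) =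
      ENNReal.ofReal (Real.exp (∑ i, ∑ j, v * c i j ^ 2 / 2)) :=
  lintegral_exp_sum_pi _ (fun i (r : Fin b → ℝ) => ∑ j, c i j * r j) (fun i => by fun_prop) _
    fun i => lintegral_exp_sum_pi _ (fun j (x : ℝ) => c i j * x) (fun j => by fun_prop) _
      fun j => lintegral_exp_mul_gaussianReal v (c i j)

theorem sum_sum_sq_mul_eq {a b : ℕ} (x : EuclideanSpace ℝ (Fin b)) (y : EuclideanSpace ℝ (Fin a))
    (v : ℝ) :
    ∑ i, ∑ j, v * (y i * x j) ^ 2 / 2 = v * (‖x‖ ^ 2 * ‖y‖ ^ 2) / 2 := by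
  rw [EuclideanSpace.real_norm_sq_eq, EuclideanSpace.real_norm_sq_eq, mul_comm (∑ i, x i ^ 2),
    Finset.sum_mul_sum, Finset.mul_sum, Finset.sum_div]
  refine Finset.sum_congr rfl fun i _ => ?_
  rw [Finset.mul_sum, Finset.sum_div]
  exact Finset.sum_congr rfl fun j _ => by ring

end GaussianMGF

/-! ### Tail bounds at initialization -/

section Initialization

variable {m p d K : ℕ}

instance isProbabilityMeasure_initLaw : IsProbabilityMeasure (initLaw m p d K) := by
  unfold initLaw; infer_instance

theorem measurePreserving_initLaw_fst :
    MeasurePreserving (fun θ : InitSpace m p d K => θ.1) (initLaw m p d K)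
      (Measure.pi fun _ => Measure.pi fun _ => gaussianReal 0 (2 / (m : ℝ≥0))) :=
  measurePreserving_fst

theorem measurePreserving_initLaw_weights :
    MeasurePreserving (fun θ : InitSpace m p d K => θ.2.1) (initLaw m p d K)
      (Measure.pi fun _ => Measure.pi fun _ => Measure.pi fun _ =>
        gaussianReal 0 (2 / (m : ℝ≥0))) :=
  measurePreserving_fst.comp measurePreserving_snd

theorem measurePreserving_initLaw_output :
    MeasurePreserving (fun θ : InitSpace m p d K => θ.2.2) (initLaw m p d K)
      (Measure.pi fun _ => Measure.pi fun _ => gaussianReal 0 (2 / (d : ℝ≥0))) :=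
  measurePreserving_snd.comp measurePreserving_snd

theorem continuous_toEuclideanCLM :
    Continuous fun M : Matrix (Fin m) (Fin m) ℝ => Matrix.toEuclideanCLM (n := Fin m) (𝕜 := ℝ) M :=
  (Matrix.toEuclideanCLM (n := Fin m) (𝕜 := ℝ)).toAlgEquiv.toLinearMap.continuous_of_finiteDimensional

/-- A sum of `#s` independent weight matrices has spectral norm `O(√#s)`. -/
theorem measure_sum_weights_gt_le (hm : 1 ≤ m) (s : Finset (Fin (K + 1))) (hs : s.Nonempty) :
    initLaw m p d K {θ | 64 * √s.card <
        ‖∑ l ∈ s, Matrix.toEuclideanCLM (n := Fin m) (𝕜 := ℝ) (θ.W l)‖} ≤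
      ENNReal.ofReal (Real.exp (-(12 * m))) := by
  have hm0 : (0 : ℝ) < m := by exact_mod_cast hm
  have hs0 : (0 : ℝ) < s.card := by exact_mod_cast hs.card_pos
  have hsq : √(s.card : ℝ) ^ 2 = s.card := Real.sq_sqrt hs0.le
  have hsp : 0 < √(s.card : ℝ) := Real.sqrt_pos.2 hs0
  -- The bilinear form has variance proxy `2 #s / m`; `t = m / √#s` makes `s * t ^ 2 = 2 m` and the
  -- threshold `64 √#s`.
  have key := measure_opNorm_gt_le (initLaw m p d K)
    (G := fun θ => ∑ l ∈ s, Matrix.toEuclideanCLM (n := Fin m) (𝕜 := ℝ) (θ.W l))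
    (s := 2 / m * s.card) (t := m / √s.card) ?_ (by positivity) (by positivity) ?_ m ?_ ?_
  · have e : 64 * (m : ℝ) / (m / √s.card) = 64 * √s.card := by field_simp
    rwa [e] at key
  · refine continuous_finsetSum _ fun l _ => continuous_toEuclideanCLM.comp ?_
    unfold InitSpace.W
    fun_prop
  · intro x y
    have e : ∀ θ : InitSpace m p d K,
        inner ℝ y ((∑ l ∈ s, Matrix.toEuclideanCLM (n := Fin m) (𝕜 := ℝ) (θ.W l)) x) =
        ∑ l, ∑ i, ∑ j, (if l ∈ s then y i * x j else 0) * θ.2.1 l i j := by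
      intro θ
      rw [sum_apply, inner_sum, ← Finset.sum_filter_add_sum_filter_not
        Finset.univ (· ∈ s) (fun l => ∑ i, ∑ j, (if l ∈ s then y i * x j else 0) * θ.2.1 l i j)]
      rw [Finset.sum_eq_zero (s := Finset.univ.filter (¬ · ∈ s)), add_zero, Finset.filter_mem_eq_inter,
        Finset.univ_inter]
      · refine Finset.sum_congr rfl fun l hl => ?_
        simp only [hl, if_true]
        rw [Matrix.inner_toEuclideanCLM]
        simp only [dotProduct, Matrix.mulVec, InitSpace.W, Matrix.of_apply, Finset.mul_sum]
        exact Finset.sum_congr rfl fun i _ => Finset.sum_congr rfl fun j _ => by ring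
      · intro l hl
        simp [(Finset.mem_filter.1 hl).2]
    simp_rw [e]
    rw [(measurePreserving_initLaw_weights (m := m) (p := p) (d := d) (K := K)).lintegral_comp
      (f := fun M => ENNReal.ofReal (Real.exp (∑ l, ∑ i, ∑ j,
        (if l ∈ s then y i * x j else 0) * M l i j))) (by fun_prop),
      lintegral_exp_sum_pi _ (fun l (M : Fin m → Fin m → ℝ) => ∑ i, ∑ j,
        (if l ∈ s then y i * x j else 0) * M i j) (fun l => by fun_prop) _
        (fun l => lintegral_exp_matrix_gaussian m m (2 / (m : ℝ≥0))
          (fun i j => if l ∈ s then y i * x j else 0))]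
    refine ENNReal.ofReal_le_ofReal (Real.exp_le_exp.2 (le_of_eq ?_))
    have e2 : ∀ l : Fin (K + 1), ∑ i, ∑ j, ((2 / (m : ℝ≥0) : ℝ≥0) : ℝ) *
        (if l ∈ s then y i * x j else 0) ^ 2 / 2 =
        if l ∈ s then 2 / m * (‖x‖ ^ 2 * ‖y‖ ^ 2) / 2 else 0 := by
      intro l
      split_ifs with h
      · rw [sum_sum_sq_mul_eq]; simp
      · simp
    rw [Finset.sum_congr rfl fun l _ => e2 l, Finset.sum_ite_mem, Finset.univ_inter,
      Finset.sum_const, nsmul_eq_mul]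
    ring
  · simp [two_mul]
  · rw [div_pow, hsq]
    field_simp
    rfl

/-- The output matrix has spectral norm `O(√(m / d))`. -/
theorem measure_output_gt_le (hm : 1 ≤ m) (hd : 1 ≤ d) (hdm : d ≤ m) :
    initLaw m p d K {θ | 64 * √((m : ℝ) / d) <
        ‖LinearMap.toContinuousLinearMap (Matrix.toEuclideanLin (𝕜 := ℝ) (θ.B)ᵀ)‖} ≤
      ENNReal.ofReal (Real.exp (-(12 * m))) := by
  have hm0 : (0 : ℝ) < m := by exact_mod_cast hm
  have hd0 : (0 : ℝ) < d := by exact_mod_cast hd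
  have key := measure_opNorm_gt_le (initLaw m p d K)
    (G := fun θ => LinearMap.toContinuousLinearMap (Matrix.toEuclideanLin (𝕜 := ℝ) (θ.B)ᵀ))
    (s := 2 / d) (t := √m * √d) ?_ (by positivity) (by positivity) ?_ m ?_ ?_
  · have e : 64 * (m : ℝ) / (√m * √d) = 64 * √((m : ℝ) / d) := by
      rw [Real.sqrt_div hm0.le]
      have := Real.mul_self_sqrt hm0.le
      field_simp
      nlinarith
    rwa [e] at key
  · have h1 : Continuous fun M : Matrix (Fin m) (Fin d) ℝ =>
        LinearMap.toContinuousLinearMap (Matrix.toEuclideanLin (𝕜 := ℝ) M) := by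
      let f : Matrix (Fin m) (Fin d) ℝ →ₗ[ℝ]
          EuclideanSpace ℝ (Fin d) →L[ℝ] EuclideanSpace ℝ (Fin m) :=
        LinearMap.toContinuousLinearMap.toLinearMap ∘ₗ
          (Matrix.toEuclideanLin (𝕜 := ℝ)).toLinearMap
      exact f.continuous_of_finiteDimensional
    refine h1.comp ?_
    unfold InitSpace.B
    fun_prop
  · intro x y
    have e : ∀ θ : InitSpace m p d K,
        inner ℝ y (LinearMap.toContinuousLinearMap (Matrix.toEuclideanLin (𝕜 := ℝ) (θ.B)ᵀ) x) =
        ∑ i, ∑ j, (x i * y j) * θ.2.2 i j := by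
      intro θ
      rw [Finset.sum_comm]
      simp only [LinearMap.coe_toContinuousLinearMap', Matrix.toLpLin_apply,
        PiLp.inner_apply, Matrix.mulVec, dotProduct, Matrix.transpose_apply, InitSpace.B,
        Matrix.of_apply, RCLike.inner_apply, conj_trivial, Finset.sum_mul]
      exact Finset.sum_congr rfl fun i _ => Finset.sum_congr rfl fun j _ => by ring
    simp_rw [e]
    rw [(measurePreserving_initLaw_output (m := m) (p := p) (d := d) (K := K)).lintegral_comp
      (f := fun M => ENNReal.ofReal (Real.exp (∑ i, ∑ j, (x i * y j) * M i j))) (by fun_prop),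
      lintegral_exp_matrix_gaussian d m (2 / (d : ℝ≥0)) (fun i j => x i * y j), sum_sum_sq_mul_eq]
    refine ENNReal.ofReal_le_ofReal (Real.exp_le_exp.2 (le_of_eq ?_))
    rw [mul_comm (‖y‖ ^ 2)]
    simp
  · simp; omega
  · rw [mul_pow, Real.sq_sqrt hm0.le, Real.sq_sqrt hd0.le]
    field_simp
    rfl

/-- The vector is viewed as an operator from `ℝ`, so the exponential moment above applies. The
moment of order `2 m` is the highest order still of size `exp (O(m))` that is needed to get an `exp
(-12 m)` tail for an average over the data. -/
theorem lintegral_norm_pow_le (hm : 1 ≤ m) (x : EuclideanSpace ℝ (Fin p)) (hx : ‖x‖ = 1) :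
    ∫⁻ θ, ENNReal.ofReal (‖WithLp.toLp 2 (θ.A *ᵥ x.ofLp)‖ ^ (2 * m)) ∂(initLaw m p d K) ≤
      ENNReal.ofReal (Real.exp (12 * m)) := by
  have hm0 : (0 : ℝ) < m := by exact_mod_cast hm
  have key := lintegral_exp_opNorm_le (initLaw m p d K) (E := ℝ)
    (G := fun θ => ContinuousLinearMap.toSpanSingleton ℝ (WithLp.toLp 2 (θ.A *ᵥ x.ofLp)))
    (s := 2 / m) (t := m) ?_ (by positivity) hm0.le ?_
  · simp only [ContinuousLinearMap.norm_toSpanSingleton] at key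
    have h1 : ∀ θ : InitSpace m p d K,
        ENNReal.ofReal (‖WithLp.toLp 2 (θ.A *ᵥ x.ofLp)‖ ^ (2 * m)) ≤
        ENNReal.ofReal (Real.exp (4 * m)) * ENNReal.ofReal (Real.exp (5 / 16 * m *
          ‖WithLp.toLp 2 (θ.A *ᵥ x.ofLp)‖)) := by
      intro θ
      rw [← ENNReal.ofReal_mul (Real.exp_pos _).le]
      apply ENNReal.ofReal_le_ofReal
      set Z := ‖WithLp.toLp 2 (θ.A *ᵥ x.ofLp)‖
      have hZ : 0 ≤ Z := norm_nonneg _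
      -- One Taylor term of the exponential dominates the power; the factorial costs only `(32/5) ^
      -- (2 m) ≤ exp (4 m)`.
      have h2 := Real.pow_div_factorial_le_exp (5 / 16 * m * Z) (by positivity) (2 * m)
      rw [div_le_iff₀ (by positivity)] at h2
      have h3 : ((2 * m).factorial : ℝ) ≤ (2 * m) ^ (2 * m) := by
        exact_mod_cast Nat.factorial_le_pow (2 * m)
      have h4 : (5 / 16 * m * Z) ^ (2 * m) ≤
          Real.exp (5 / 16 * m * Z) * (2 * m) ^ (2 * m) := h2.trans (by gcongr)
      rw [mul_pow] at h4
      have h5 : (2 * (m : ℝ)) ^ (2 * m) ≤ Real.exp (4 * m) * (5 / 16 * m) ^ (2 * m) := by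
        have h6 : (32 / 5 : ℝ) ≤ Real.exp 2 := by
          have h' := Real.exp_one_gt_d9
          rw [show (2 : ℝ) = 1 + 1 by norm_num, Real.exp_add]
          nlinarith
        calc (2 * (m : ℝ)) ^ (2 * m) = (32 / 5) ^ (2 * m) * (5 / 16 * m) ^ (2 * m) := by
              rw [← mul_pow]; ring_nf
          _ ≤ Real.exp 2 ^ (2 * m) * (5 / 16 * m) ^ (2 * m) := by gcongr
          _ = _ := by rw [← Real.exp_nat_mul]; push_cast; ring_nf
      have h7 : 0 < (5 / 16 * (m : ℝ)) ^ (2 * m) := by positivity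
      refine le_of_mul_le_mul_left ?_ h7
      have := mul_le_mul_of_nonneg_left h5 (Real.exp_pos (5 / 16 * m * Z)).le
      linarith
    refine (lintegral_mono h1).trans ?_
    rw [lintegral_const_mul' _ _ ENNReal.ofReal_ne_top]
    refine (mul_le_mul_right key _).trans ?_
    rw [← ENNReal.ofReal_mul (Real.exp_pos _).le]
    apply ENNReal.ofReal_le_ofReal
    have h8 := five_pow_mul_exp_le (N := Module.finrank ℝ ℝ +
      Module.finrank ℝ (EuclideanSpace ℝ (Fin m))) (m := m) (q := 2 / m * m ^ 2)
      (by simp; omega) (by field_simp; rfl)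
    refine (mul_le_mul_of_nonneg_left h8 (Real.exp_pos _).le).trans_eq ?_
    rw [← Real.exp_add]; ring_nf
  · refine (ContinuousLinearMap.toSpanSingletonCLE (𝕜 := ℝ)
      (E := EuclideanSpace ℝ (Fin m))).continuous.comp ?_
    unfold InitSpace.A
    fun_prop
  · intro c y
    have e : ∀ θ : InitSpace m p d K, inner ℝ y
        (ContinuousLinearMap.toSpanSingleton ℝ (WithLp.toLp 2 (θ.A *ᵥ x.ofLp)) c) =
        ∑ i, ∑ j, (y i * (c • x) j) * θ.1 i j := by
      intro θ
      simp only [ContinuousLinearMap.toSpanSingleton_apply, PiLp.inner_apply, Matrix.mulVec,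
        dotProduct, InitSpace.A, Matrix.of_apply, RCLike.inner_apply, conj_trivial, Finset.sum_mul,
        PiLp.smul_apply, smul_eq_mul, Finset.mul_sum]
      exact Finset.sum_congr rfl fun i _ => Finset.sum_congr rfl fun j _ => by ring
    simp_rw [e]
    rw [(measurePreserving_initLaw_fst (m := m) (p := p) (d := d) (K := K)).lintegral_comp
      (f := fun M => ENNReal.ofReal (Real.exp (∑ i, ∑ j, (y i * (c • x) j) * M i j)))
      (by fun_prop),
      lintegral_exp_matrix_gaussian m p (2 / (m : ℝ≥0)) (fun i j => y i * (c • x) j),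
      sum_sum_sq_mul_eq]
    refine ENNReal.ofReal_le_ofReal (Real.exp_le_exp.2 (le_of_eq ?_))
    rw [norm_smul, hx]
    simp

/-- The average squared norm of the first layer over unit data is `O(1)`. -/
theorem measure_sum_sq_norm_gt_le (hm : 1 ≤ m) {n : ℕ} (x : Fin n → EuclideanSpace ℝ (Fin p))
    (hx : ∀ i, ‖x i‖ = 1) :
    initLaw m p d K {θ | Real.exp 24 * n <
        ∑ i, ‖WithLp.toLp 2 (θ.A *ᵥ (x i).ofLp)‖ ^ 2} ≤
      ENNReal.ofReal (Real.exp (-(12 * m))) := by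
  rcases Nat.eq_zero_or_pos n with rfl | hn
  · simp
  have hn0 : (0 : ℝ) < n := by exact_mod_cast hn
  set f : InitSpace m p d K → ℝ≥0∞ := fun θ => ∑ i, ENNReal.ofReal ((n : ℝ)⁻¹ *
    ‖WithLp.toLp 2 (θ.A *ᵥ (x i).ofLp)‖ ^ (2 * m)) with hf
  have hcont : ∀ i, Measurable fun θ : InitSpace m p d K =>
      ENNReal.ofReal ((n : ℝ)⁻¹ * ‖WithLp.toLp 2 (θ.A *ᵥ (x i).ofLp)‖ ^ (2 * m)) := by
    intro i
    refine (ENNReal.continuous_ofReal.comp ?_).measurable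
    unfold InitSpace.A
    fun_prop
  have hmeas : Measurable f := Finset.measurable_fun_sum _ fun i _ => hcont i
  have hint : ∫⁻ θ, f θ ∂(initLaw m p d K) ≤ ENNReal.ofReal (Real.exp (12 * m)) := by
    rw [lintegral_finsetSum _ fun i _ => hcont i]
    have h1 : ∀ i, ∫⁻ θ, ENNReal.ofReal ((n : ℝ)⁻¹ *
        ‖WithLp.toLp 2 (θ.A *ᵥ (x i).ofLp)‖ ^ (2 * m)) ∂(initLaw m p d K) ≤
        ENNReal.ofReal (n : ℝ)⁻¹ * ENNReal.ofReal (Real.exp (12 * m)) := by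
      intro i
      simp_rw [ENNReal.ofReal_mul (by positivity : (0 : ℝ) ≤ (n : ℝ)⁻¹)]
      rw [lintegral_const_mul' _ _ ENNReal.ofReal_ne_top]
      gcongr
      exact lintegral_norm_pow_le hm (x i) (hx i)
    refine (Finset.sum_le_sum fun i _ => h1 i).trans_eq ?_
    rw [Finset.sum_const, Finset.card_univ, Fintype.card_fin, nsmul_eq_mul, ← mul_assoc,
      ← ENNReal.ofReal_natCast, ← ENNReal.ofReal_mul hn0.le, mul_inv_cancel₀ hn0.ne',
      ENNReal.ofReal_one, one_mul]
  have h2 := mul_meas_ge_le_lintegral (μ := initLaw m p d K) hmeas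
    (ENNReal.ofReal (Real.exp (24 * m)))
  have h3 : initLaw m p d K {θ | Real.exp 24 * n <
      ∑ i, ‖WithLp.toLp 2 (θ.A *ᵥ (x i).ofLp)‖ ^ 2} ≤
      initLaw m p d K {θ | ENNReal.ofReal (Real.exp (24 * m)) ≤ f θ} := by
    refine measure_mono fun θ hθ => ?_
    replace hθ : Real.exp 24 * n < ∑ i, ‖WithLp.toLp 2 (θ.A *ᵥ (x i).ofLp)‖ ^ 2 := hθ
    change ENNReal.ofReal (Real.exp (24 * m)) ≤ f θ
    rw [hf]
    simp only
    rw [← ENNReal.ofReal_sum_of_nonneg fun i _ => by positivity]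
    apply ENNReal.ofReal_le_ofReal
    -- Convexity passes the `m`-th power inside the average over the data, so Markov's inequality
    -- gives a bound that does not depend on `n`.
    have h4 := Real.pow_arith_mean_le_arith_mean_pow Finset.univ (fun _ : Fin n => (n : ℝ)⁻¹)
      (fun i => ‖WithLp.toLp 2 (θ.A *ᵥ (x i).ofLp)‖ ^ 2) (fun _ _ => by positivity)
      (by simp [hn0.ne']) (fun _ _ => by positivity) m
    simp_rw [← pow_mul] at h4
    refine le_trans ?_ h4
    have h5 : Real.exp (24 * m) = Real.exp 24 ^ m := by
      rw [← Real.exp_nat_mul]; ring_nf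
    rw [h5, ← Finset.mul_sum]
    refine pow_le_pow_left₀ (Real.exp_pos _).le ?_ m
    rw [inv_mul_eq_div, le_div_iff₀ hn0]
    exact hθ.le
  have h4 : ENNReal.ofReal (Real.exp (24 * m)) * initLaw m p d K {θ | Real.exp 24 * n <
      ∑ i, ‖WithLp.toLp 2 (θ.A *ᵥ (x i).ofLp)‖ ^ 2} ≤
      ENNReal.ofReal (Real.exp (24 * m)) * ENNReal.ofReal (Real.exp (-(12 * m))) := by
    rw [← ENNReal.ofReal_mul (Real.exp_pos _).le, ← Real.exp_add]
    refine ((mul_le_mul_right h3 _).trans h2).trans (hint.trans_eq ?_)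
    ring_nf
  rwa [ENNReal.mul_le_mul_iff_right (by simp [Real.exp_pos]) ENNReal.ofReal_ne_top] at h4

end Initialization

/-! ### Norm propagation through perturbed residual layers -/

section Propagation

/-- Here `e` is the effect of the perturbation and `b` that of the initial weight. The damping `ρ =
1 / (1 + 2κ)` is twice as strong as `e` requires; the surplus pays for the cross terms of order
`τκ`, and this is where `τ ≤ 1/200` enters. -/
theorem sq_norm_damped_step_le {V : Type*} [NormedAddCommGroup V] [InnerProductSpace ℝ V]
    {v e b : V} {τ κ ρ : ℝ} (hτ : 0 ≤ τ) (hτs : τ ≤ 1 / 200) (hκ0 : 0 ≤ κ) (hρ0 : 0 < ρ)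
    (hρκ : ρ * (1 + 2 * κ) = 1) (hen : ‖e‖ ≤ κ * ‖v‖) (hbn : ‖b‖ ≤ 64 * ‖v‖) :
    ‖ρ • (v + e + τ • b)‖ ^ 2 ≤ ‖v‖ ^ 2 + 2 * τ * inner ℝ v (ρ • b) +
      64 ^ 2 * τ ^ 2 * ‖v‖ ^ 2 := by
  have hρ1 : ρ ≤ 1 := by nlinarith [mul_nonneg hρ0.le hκ0]
  have hone : 1 - ρ = 2 * κ * ρ := by linarith
  have hve : ‖v + e‖ ^ 2 ≤ (1 + κ) ^ 2 * ‖v‖ ^ 2 := by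
    rw [← mul_pow]
    refine pow_le_pow_left₀ (norm_nonneg _) ?_ 2
    linarith [norm_add_le v e]
  have hvb : |inner ℝ v b| ≤ 64 * ‖v‖ ^ 2 :=
    (abs_real_inner_le_norm v b).trans ((mul_le_mul_of_nonneg_left hbn (norm_nonneg v)).trans_eq (by ring))
  have heb : |inner ℝ e b| ≤ 64 * κ * ‖v‖ ^ 2 :=
    (abs_real_inner_le_norm e b).trans
      ((mul_le_mul hen hbn (norm_nonneg _) (by positivity)).trans_eq (by ring))
  have hb2 : ‖b‖ ^ 2 ≤ 64 ^ 2 * ‖v‖ ^ 2 := by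
    rw [← mul_pow]; exact pow_le_pow_left₀ (norm_nonneg _) hbn 2
  rw [norm_smul, mul_pow, Real.norm_eq_abs, sq_abs, norm_add_sq_real (v + e), norm_smul,
    mul_pow, Real.norm_eq_abs, sq_abs, real_inner_smul_right, inner_add_left,
    real_inner_smul_right]
  have q1 : ρ ^ 2 * (2 * (τ * inner ℝ v b)) ≤ 2 * τ * (ρ * inner ℝ v b) +
      ρ ^ 2 * (256 * τ * κ * ‖v‖ ^ 2) := by
    have h1 : 2 * τ * (ρ * inner ℝ v b) - ρ ^ 2 * (2 * (τ * inner ℝ v b)) =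
        ρ ^ 2 * (4 * κ * τ * inner ℝ v b) := by
      have : ρ ^ 2 * (4 * κ * τ * inner ℝ v b) = ρ * (2 * τ * inner ℝ v b) * (2 * κ * ρ) := by
        ring
      rw [this, ← hone]; ring
    have h2 : -(64 * ‖v‖ ^ 2) ≤ inner ℝ v b := (neg_le_neg hvb).trans (neg_abs_le _)
    have h3 := mul_le_mul_of_nonneg_left h2 (by positivity : 0 ≤ ρ ^ 2 * (4 * κ * τ))
    linarith
  have q2 : ρ ^ 2 * (2 * (τ * inner ℝ e b)) ≤ ρ ^ 2 * (128 * τ * κ * ‖v‖ ^ 2) := by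
    have h3 := mul_le_mul_of_nonneg_left ((le_abs_self _).trans heb)
      (by positivity : 0 ≤ 2 * τ)
    refine mul_le_mul_of_nonneg_left ?_ (by positivity)
    linarith
  have q3 : ρ ^ 2 * (τ ^ 2 * ‖b‖ ^ 2) ≤ 64 ^ 2 * τ ^ 2 * ‖v‖ ^ 2 := by
    have h1 : ρ ^ 2 ≤ 1 := pow_le_one₀ hρ0.le hρ1
    refine (mul_le_of_le_one_left (by positivity) h1).trans ?_
    have := mul_le_mul_of_nonneg_left hb2 (sq_nonneg τ)
    linarith
  have q4 : ρ ^ 2 * (‖v + e‖ ^ 2 + 384 * τ * κ * ‖v‖ ^ 2) ≤ ‖v‖ ^ 2 := by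
    have h1 : (1 + κ) ^ 2 + 384 * τ * κ ≤ (1 + 2 * κ) ^ 2 := by
      nlinarith [mul_nonneg hκ0 (sub_nonneg.2 hτs), sq_nonneg κ]
    calc ρ ^ 2 * (‖v + e‖ ^ 2 + 384 * τ * κ * ‖v‖ ^ 2) ≤
          ρ ^ 2 * (((1 + κ) ^ 2 + 384 * τ * κ) * ‖v‖ ^ 2) := by
          gcongr; linarith
      _ ≤ ρ ^ 2 * ((1 + 2 * κ) ^ 2 * ‖v‖ ^ 2) := by gcongr
      _ = (ρ * (1 + 2 * κ)) ^ 2 * ‖v‖ ^ 2 := by ring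
      _ = ‖v‖ ^ 2 := by rw [hρκ]; ring
  linarith

/-- The perturbation shows no cancellation, but it grows the norm by at most a factor `1 + 1/L` per
layer. The damped path `ρ ^ l • h l` obeys the energy inequality with the initial weights alone, and
undamping costs a constant. -/
theorem sq_norm_le_of_residual_path {K m N : ℕ} (hK : 1 ≤ K) (hKm : K + 1 ≤ m) (hN : N ≤ K) {τ : ℝ}
    (hτ : 0 < τ) (hτ' : τ * (√(K + 1 : ℕ) * Real.log m) ≤ 1 / 10 ^ 7)
    {w₀ w : ℕ → EuclideanSpace ℝ ι →L[ℝ] EuclideanSpace ℝ ι} {h : ℕ → EuclideanSpace ℝ ι}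
    (hS : ∀ a T : ℕ, a + T ≤ N → ‖∑ l ∈ Finset.range T, w₀ (a + l)‖ ≤ 64 * √T)
    (hw : ∀ l < N, τ * ‖w l - w₀ l‖ ≤ 1 / (K + 1 : ℕ))
    (hh : ∀ l < N, ∀ i, h (l + 1) i = (h l + τ • w l (h l)) i ∨ h (l + 1) i = 0)
    (l : ℕ) (hl : l ≤ N) :
    ‖h l‖ ^ 2 ≤ 2 * Real.exp 4 * ‖h 0‖ ^ 2 := by
  have hm2 : (2 : ℝ) ≤ m := by exact_mod_cast (by omega : 2 ≤ m)
  have hlog2 := Real.log_two_gt_d9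
  have hlog : Real.log 2 ≤ Real.log m := Real.log_le_log (by norm_num) hm2
  have hτs : τ ≤ 1 / 200 := by
    have h1 : 1 ≤ √((K + 1 : ℕ) : ℝ) := Real.one_le_sqrt.2 (by push_cast; linarith [Nat.cast_nonneg (α := ℝ) K])
    have h2 : 1 / 2 ≤ √((K + 1 : ℕ) : ℝ) * Real.log m := by nlinarith
    have h3 := mul_le_mul_of_nonneg_left h2 hτ.le
    linarith
  set κ : ℝ := 1 / (K + 1 : ℕ) with hκ
  have hK1 : (0 : ℝ) < (K + 1 : ℕ) := by positivity
  have hκ0 : 0 < κ := by positivity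
  set ρ : ℝ := (1 + 2 * κ)⁻¹ with hρ
  have hρ0 : 0 < ρ := by positivity
  have hρκ : ρ * (1 + 2 * κ) = 1 := inv_mul_cancel₀ (by positivity)
  have hρ1 : ρ ≤ 1 := by nlinarith [mul_pos hρ0 hκ0]
  have hone : 1 - ρ = 2 * κ * ρ := by linarith
  -- The number of dyadic levels; with `K + 1 ≤ m` it is `O(log m)`, the source of the logarithm in
  -- the condition on `τ`.
  set J := Nat.clog 2 (K + 1) with hJ
  have hJ1 : 1 ≤ J := Nat.clog_pos (by norm_num) (by omega)
  have hJK : K + 1 ≤ 2 ^ J := Nat.le_pow_clog (by norm_num) _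
  have hJK' : 2 ^ J ≤ 2 * (K + 1) := by
    have h1 := Nat.pow_pred_clog_lt_self (b := 2) (by norm_num) (x := K + 1) (by omega)
    have h2 : 2 ^ J = 2 * 2 ^ (J - 1) := by
      rw [← pow_succ', Nat.sub_add_cancel hJ1]
    rw [h2]
    exact Nat.mul_le_mul_left 2 h1.le
  have hJR : (2 : ℝ) ^ J ≤ 2 * (K + 1 : ℕ) := by exact_mod_cast hJK'
  have hJlog : (J : ℝ) ≤ 3 * Real.log m := by
    have h1 : (2 : ℝ) ^ J ≤ m ^ 2 := by
      have h2 : ((K + 1 : ℕ) : ℝ) ≤ m := by exact_mod_cast hKm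
      nlinarith
    have h2 := Real.log_le_log (by positivity) h1
    rw [Real.log_pow, Real.log_pow] at h2
    push_cast at h2
    have h3 : (0 : ℝ) ≤ J := Nat.cast_nonneg _
    nlinarith
  have hsqrt : √(2 ^ J : ℝ) ≤ 3 / 2 * √(K + 1 : ℕ) := by
    rw [Real.sqrt_le_left (by positivity), mul_pow, Real.sq_sqrt hK1.le]
    linarith
  have hε : 64 * (τ * √(2 ^ J) * J) ≤ 1 / 30000 := by
    have h1 : √(2 ^ J) * J ≤ 3 / 2 * √(K + 1 : ℕ) * (3 * Real.log m) :=
      mul_le_mul hsqrt hJlog (Nat.cast_nonneg _) (by positivity)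
    have h2 := mul_le_mul_of_nonneg_left h1 hτ.le
    have h3 : τ * (3 / 2 * √(K + 1 : ℕ) * (3 * Real.log m)) =
      9 / 2 * (τ * (√(K + 1 : ℕ) * Real.log m)) := by ring
    rw [h3] at h2
    rw [mul_assoc τ]
    linarith
  have hstep : ∀ (j : ℕ) (v : EuclideanSpace ℝ ι),
      v + (τ • (ρ • w₀ j) v + (ρ • τ • (w j - w₀ j) v - (1 - ρ) • v)) =
        ρ • (v + τ • w j v) := by
    intro j v
    simp only [smul_apply, sub_apply]
    module
  have key := sq_norm_le_of_path (u := fun l => ρ ^ l • h l) (w := fun l => ρ • w₀ l)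
    (r := fun l => ρ • τ • (w l - w₀ l) (ρ ^ l • h l) - (1 - ρ) • (ρ ^ l • h l))
    (τ := τ) (σ := 64) (κ := 3 * κ) N (by norm_num) hτ.le (by positivity) ?_ ?_ ?_ ?_ J hJ1
    (by omega) ?_ hε l hl
  · simp only [pow_zero, one_smul, norm_smul, norm_pow, Real.norm_eq_abs, abs_of_pos hρ0] at key
    rw [mul_pow] at key
    -- Undamping: `l κ ≤ 1`, so `(1 + 2κ) ^ l ≤ exp 2`.
    have h1 : 1 ≤ Real.exp 4 * (ρ ^ l) ^ 2 := by
      have h2 : (1 + 2 * κ) ^ l ≤ Real.exp 2 := by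
        calc (1 + 2 * κ) ^ l ≤ Real.exp (2 * κ) ^ l := by
              gcongr
              linarith [Real.add_one_le_exp (2 * κ)]
          _ = Real.exp (l * (2 * κ)) := (Real.exp_nat_mul _ _).symm
          _ ≤ Real.exp 2 := by
              apply Real.exp_le_exp.2
              have h3 : (l : ℝ) ≤ (K + 1 : ℕ) := by exact_mod_cast (by omega : l ≤ K + 1)
              have h4 : ((K + 1 : ℕ) : ℝ) * κ = 1 := by rw [hκ]; field_simp
              nlinarith
      have h3 : ρ ^ l * (1 + 2 * κ) ^ l = 1 := by rw [← mul_pow, hρκ, one_pow]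
      have h4 : 1 ≤ Real.exp 2 * ρ ^ l := by
        rw [← h3, mul_comm]; gcongr
      have h5 : Real.exp 4 * (ρ ^ l) ^ 2 = (Real.exp 2 * ρ ^ l) ^ 2 := by
        rw [mul_pow, ← Real.exp_nat_mul]; norm_num
      rw [h5]
      exact one_le_pow₀ h4
    calc ‖h l‖ ^ 2 ≤ (Real.exp 4 * (ρ ^ l) ^ 2) * ‖h l‖ ^ 2 :=
          le_mul_of_one_le_left (sq_nonneg _) h1
      _ = Real.exp 4 * ((ρ ^ l) ^ 2 * ‖h l‖ ^ 2) := by ring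
      _ ≤ Real.exp 4 * (2 * ‖h 0‖ ^ 2) := by gcongr
      _ = _ := by ring
  · intro a T haT
    rw [← Finset.smul_sum, norm_smul, Real.norm_eq_abs, abs_of_pos hρ0]
    exact (mul_le_of_le_one_left (norm_nonneg _) hρ1).trans (hS a T haT)
  · intro l hl
    set v := ρ ^ l • h l
    refine (norm_sub_le _ _).trans ?_
    have h1 : ‖ρ • τ • (w l - w₀ l) v‖ ≤ κ * ‖v‖ := by
      rw [norm_smul, norm_smul, Real.norm_eq_abs, Real.norm_eq_abs, abs_of_pos hρ0, abs_of_pos hτ]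
      refine (mul_le_of_le_one_left (by positivity) hρ1).trans ?_
      calc τ * ‖(w l - w₀ l) v‖ ≤ τ * (‖w l - w₀ l‖ * ‖v‖) := by
            gcongr; exact ContinuousLinearMap.le_opNorm _ _
        _ = τ * ‖w l - w₀ l‖ * ‖v‖ := by ring
        _ ≤ κ * ‖v‖ := by gcongr; exact hw l hl
    have h2 : ‖(1 - ρ) • v‖ ≤ 2 * κ * ‖v‖ := by
      rw [norm_smul, Real.norm_eq_abs, abs_of_nonneg (by linarith), hone]
      exact mul_le_mul_of_nonneg_right (mul_le_of_le_one_right (by positivity) hρ1) (norm_nonneg _)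
    linarith
  · intro l hl i
    simp only
    rw [hstep l (ρ ^ l • h l), map_smul, smul_comm τ, ← smul_add, smul_smul, ← pow_succ']
    rcases hh l hl i with h1 | h1
    · left; rw [PiLp.smul_apply, h1, PiLp.smul_apply]
    · right; rw [PiLp.smul_apply, h1, smul_zero]
  · intro l hl
    rw [hstep l (ρ ^ l • h l)]
    set v := ρ ^ l • h l
    set b := w₀ l v with hb
    set e := τ • (w l - w₀ l) v with he
    have hv : v + τ • w l v = (v + e) + τ • b := by
      rw [he, hb, sub_apply]; module
    have hbn : ‖b‖ ≤ 64 * ‖v‖ := by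
      refine (ContinuousLinearMap.le_opNorm _ _).trans ?_
      gcongr
      simpa using hS l 1 (by omega)
    have hen : ‖e‖ ≤ κ * ‖v‖ := by
      rw [he, norm_smul, Real.norm_eq_abs, abs_of_pos hτ]
      calc τ * ‖(w l - w₀ l) v‖ ≤ τ * (‖w l - w₀ l‖ * ‖v‖) := by
            gcongr; exact ContinuousLinearMap.le_opNorm _ _
        _ = τ * ‖w l - w₀ l‖ * ‖v‖ := by ring
        _ ≤ κ * ‖v‖ := by gcongr; exact hw l hl
    rw [hv]
    exact sq_norm_damped_step_le hτ.le hτs hκ0.le hρ0 hρκ hen hbn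
  · rw [hκ]
    calc 3 * (1 / ((K + 1 : ℕ) : ℝ)) * 2 ^ J ≤ 3 * (1 / ((K + 1 : ℕ) : ℝ)) * (2 * (K + 1 : ℕ)) := by
          gcongr
      _ = 6 := by field_simp; norm_num

end Propagation

/-! ### Forward and backward signals of the network -/

section NetworkBounds

variable {m p d K : ℕ}

/-- The weights as operators on Euclidean space, extended by `0` to all indices. -/
noncomputable def weightOp (W : Weights m K) (l : ℕ) :
    EuclideanSpace ℝ (Fin m) →L[ℝ] EuclideanSpace ℝ (Fin m) :=
  if h : l < K + 1 then Matrix.toEuclideanCLM (n := Fin m) (𝕜 := ℝ) (W ⟨l, h⟩) else 0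

theorem weightOp_of_lt (W : Weights m K) {l : ℕ} (h : l < K + 1) :
    weightOp W l = Matrix.toEuclideanCLM (n := Fin m) (𝕜 := ℝ) (W ⟨l, h⟩) := dif_pos h

/-- Square-root cancellation of the sums of the weights over all intervals of layers. -/
def IntervalSumBound (W : Weights m K) : Prop :=
  ∀ a T : ℕ, a + T ≤ K + 1 → ‖∑ l ∈ Finset.range T, weightOp W (a + l)‖ ≤ 64 * √T

theorem norm_toLp_mulVec_le (M : Matrix (Fin m) (Fin m) ℝ) (v : Fin m → ℝ) :
    ‖WithLp.toLp 2 (M *ᵥ v)‖ ≤ spectralNorm M * ‖WithLp.toLp 2 v‖ :=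
  (Matrix.toEuclideanCLM (n := Fin m) (𝕜 := ℝ) M).le_opNorm (WithLp.toLp 2 v)

theorem spectralNorm_transpose (M : Matrix (Fin m) (Fin m) ℝ) :
    spectralNorm Mᵀ = spectralNorm M := by
  have h : Mᵀ = star M := by
    rw [Matrix.star_eq_conjTranspose, Matrix.conjTranspose_eq_transpose_of_trivial]
  rw [spectralNorm, spectralNorm, h, map_star, ContinuousLinearMap.star_eq_adjoint,
    LinearIsometryEquiv.norm_map]

theorem sq_norm_relu_le (v : Fin m → ℝ) :
    ‖WithLp.toLp 2 (relu v)‖ ^ 2 ≤ ‖WithLp.toLp 2 v‖ ^ 2 := by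
  rw [EuclideanSpace.real_norm_sq_eq, EuclideanSpace.real_norm_sq_eq]
  refine Finset.sum_le_sum fun i _ => ?_
  rcases max_choice 0 (v i) with h | h
  · simp [relu, h, sq_nonneg]
  · simp [relu, h]

theorem signDiag_mulVec_apply (g v : Fin m → ℝ) (i : Fin m) :
    (signDiag g *ᵥ v) i = v i ∨ (signDiag g *ᵥ v) i = 0 := by
  rw [signDiag, Matrix.mulVec_diagonal]
  split_ifs
  · left; ring
  · right; ring

theorem sq_norm_signDiag_mulVec_le (g v : Fin m → ℝ) :
    ‖WithLp.toLp 2 (signDiag g *ᵥ v)‖ ^ 2 ≤ ‖WithLp.toLp 2 v‖ ^ 2 := by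
  rw [EuclideanSpace.real_norm_sq_eq, EuclideanSpace.real_norm_sq_eq]
  refine Finset.sum_le_sum fun i _ => ?_
  rcases signDiag_mulVec_apply g v i with h | h
  · simp [h]
  · simp [h, sq_nonneg]

variable {τ w : ℝ} {W₀ W : Weights m K}

theorem InNeighborhood.mul_norm_sub_le (hτ : 0 < τ) (hw : w ≤ 1) (h : InNeighborhood τ w W₀ W)
    {l : ℕ} (hl : l < K) : τ * ‖weightOp W l - weightOp W₀ l‖ ≤ 1 / (K + 1 : ℕ) := by
  rw [weightOp_of_lt W (by omega), weightOp_of_lt W₀ (by omega), ← map_sub]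
  have h1 := (h.2 ⟨l, hl⟩).trans (min_le_right _ _)
  have hK : (0 : ℝ) < (K + 1 : ℕ) := by positivity
  have h2 := mul_le_mul_of_nonneg_left h1 hτ.le
  refine h2.trans ?_
  calc τ * (w / (τ * (K + 1 : ℕ))) = w / (K + 1 : ℕ) := by field_simp
    _ ≤ _ := by gcongr

theorem sq_norm_hiddenRep_le (hKm : K + 1 ≤ m) (hτ : 0 < τ)
    (hτ' : τ * (√(K + 1 : ℕ) * Real.log m) ≤ 1 / 10 ^ 7) (hw : w ≤ 1)
    (hS : IntervalSumBound W₀) (hW : InNeighborhood τ w W₀ W) (A : Matrix (Fin m) (Fin p) ℝ)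
    (x : EuclideanSpace ℝ (Fin p)) (k : Fin (K + 1)) :
    ‖WithLp.toLp 2 (hiddenRep τ A W x k)‖ ^ 2 ≤
      2 * Real.exp 4 * ‖WithLp.toLp 2 (A *ᵥ x.ofLp)‖ ^ 2 := by
  have h0 : ‖WithLp.toLp 2 (hiddenRep τ A W x 0)‖ ^ 2 ≤ ‖WithLp.toLp 2 (A *ᵥ x.ofLp)‖ ^ 2 :=
    sq_norm_relu_le (A *ᵥ x.ofLp)
  rcases Nat.eq_zero_or_pos K with rfl | hK
  · obtain rfl : k = 0 := Fin.fin_one_eq_zero k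
    refine h0.trans (le_mul_of_one_le_left (sq_nonneg _) ?_)
    linarith [Real.add_one_le_exp (4 : ℝ)]
  · have key := sq_norm_le_of_residual_path hK hKm le_rfl hτ hτ' (w₀ := weightOp W₀)
      (w := weightOp W) (h := fun l => if hl : l < K + 1 then
        WithLp.toLp 2 (hiddenRep τ A W x ⟨l, hl⟩) else 0) (fun a T h => hS a T (by omega))
      (fun l hl => hW.mul_norm_sub_le hτ hw hl) ?_ k (Nat.lt_succ_iff.1 k.2)
    · simp only [k.2, dif_pos, Nat.succ_pos] at key
      exact key.trans (mul_le_mul_of_nonneg_left h0 (by positivity))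
    · intro l hl i
      rw [dif_pos (by omega), dif_pos (by omega), weightOp_of_lt W (by omega)]
      have e : hiddenRep τ A W x ⟨l + 1, by omega⟩ =
          relu (preAct τ A W x ⟨l, hl⟩) :=
        Fin.induction_succ _ _ (⟨l, hl⟩ : Fin K)
      rw [e]
      rcases max_choice 0 (preAct τ A W x ⟨l, hl⟩ i) with h | h
      · exact Or.inr h
      · exact Or.inl h

/-- The masked signal is followed because one backward step takes `z` to a mask of `z + τ Wᵀ z`,
again a step with resets. The unmasked signal does not have this form. -/
theorem sq_norm_backHidden_le (hKm : K + 1 ≤ m) (hτ : 0 < τ)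
    (hτ' : τ * (√(K + 1 : ℕ) * Real.log m) ≤ 1 / 10 ^ 7) (hw : w ≤ 1)
    (hS : IntervalSumBound W₀) (hW : InNeighborhood τ w W₀ W) (A : Matrix (Fin m) (Fin p) ℝ)
    (B : Matrix (Fin d) (Fin m) ℝ) (x : EuclideanSpace ℝ (Fin p)) (v : EuclideanSpace ℝ (Fin d))
    (k : Fin K) :
    ‖WithLp.toLp 2 (signDiag (preAct τ A W x k) *ᵥ backHidden τ A B W x v k.succ)‖ ^ 2 ≤
      2 * Real.exp 4 * ‖WithLp.toLp 2 (backHidden τ A B W x v (Fin.last K))‖ ^ 2 := by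
  have hK : 1 ≤ K := Nat.pos_of_ne_zero fun h => by subst h; exact k.elim0
  -- Time runs backwards from the last residual layer, at index `K - 1`, so there are `K - 1` steps.
  have key := sq_norm_le_of_residual_path (N := K - 1) hK hKm (by omega) hτ hτ'
      (w₀ := fun l => ContinuousLinearMap.adjoint (weightOp W₀ (K - 1 - l)))
      (w := fun l => ContinuousLinearMap.adjoint (weightOp W (K - 1 - l))) (h := fun l =>
        WithLp.toLp 2 (signDiag (preAct τ A W x ⟨K - 1 - l, by omega⟩) *ᵥ
          backHidden τ A B W x v (Fin.succ ⟨K - 1 - l, by omega⟩))) ?_ ?_ ?_ (K - 1 - k) (by omega)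
  · have e : (⟨K - 1 - (K - 1 - k), by omega⟩ : Fin K) = k := by
      ext; simp only; omega
    simp only [e] at key
    refine key.trans ?_
    gcongr ?_ * ?_
    refine (sq_norm_signDiag_mulVec_le _ _).trans (le_of_eq ?_)
    congr 4
    ext; simp only [Fin.val_succ, Fin.val_last]; omega
  -- Taking adjoints preserves norms and reversing time maps intervals of layers to intervals, so
  -- the same event serves both directions.
  · intro a T haT
    rw [← map_sum, LinearIsometryEquiv.norm_map]
    have e : ∑ l ∈ Finset.range T, weightOp W₀ (K - 1 - (a + l)) =
        ∑ l ∈ Finset.range T, weightOp W₀ (K - a - T + l) := by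
      rw [← Finset.sum_range_reflect (fun l => weightOp W₀ (K - a - T + l))]
      refine Finset.sum_congr rfl fun l hl => ?_
      rw [Finset.mem_range] at hl
      congr 1; omega
    rw [e]
    exact hS _ _ (by omega)
  · intro l hl
    rw [← map_sub, LinearIsometryEquiv.norm_map]
    exact hW.mul_norm_sub_le hτ hw (by omega)
  · intro l hl i
    set q : Fin K := ⟨K - 1 - l, by omega⟩ with hq
    have e1 : (Fin.succ ⟨K - 1 - (l + 1), by omega⟩ : Fin (K + 1)) = q.castSucc := by
      ext; simp only [Fin.val_succ, Fin.val_castSucc, hq]; omega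
    have e2 : backHidden τ A B W x v q.castSucc = (1 + τ • W q.castSucc)ᵀ *ᵥ
        (signDiag (preAct τ A W x q) *ᵥ backHidden τ A B W x v q.succ) :=
      Fin.reverseInduction_castSucc _
    have e3 : ContinuousLinearMap.adjoint (weightOp W (K - 1 - l)) =
        Matrix.toEuclideanCLM (n := Fin m) (𝕜 := ℝ) (W q.castSucc)ᵀ := by
      rw [weightOp_of_lt W (by omega), ← ContinuousLinearMap.star_eq_adjoint, ← map_star, Matrix.star_eq_conjTranspose,
        Matrix.conjTranspose_eq_transpose_of_trivial]
      rfl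
    rw [e1, e2, e3]
    set z := signDiag (preAct τ A W x q) *ᵥ backHidden τ A B W x v q.succ
    have e4 : (1 + τ • W q.castSucc)ᵀ *ᵥ z = z + τ • ((W q.castSucc)ᵀ *ᵥ z) := by
      rw [Matrix.transpose_add, Matrix.transpose_one, Matrix.transpose_smul, Matrix.add_mulVec,
        Matrix.one_mulVec, Matrix.smul_mulVec]
    rw [e4]
    exact signDiag_mulVec_apply _ _ i

theorem spectralNorm_top_le (hw : w ≤ 1) (hS : IntervalSumBound W₀)
    (hW : InNeighborhood τ w W₀ W) : spectralNorm (W (Fin.last K)) ≤ 65 := by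
  have h1 : spectralNorm (W₀ (Fin.last K)) ≤ 64 := by
    have := hS K 1 le_rfl
    rw [Finset.sum_range_one, add_zero, weightOp_of_lt W₀ (Nat.lt_succ_self K)] at this
    exact this.trans_eq (by simp)
  have h2 : spectralNorm (W (Fin.last K)) ≤ spectralNorm (W₀ (Fin.last K)) +
      spectralNorm (W (Fin.last K) - W₀ (Fin.last K)) := by
    unfold spectralNorm
    rw [map_sub]
    exact norm_le_norm_add_norm_sub' _ _
  linarith [hW.1]

theorem sq_norm_backTop_le (A : Matrix (Fin m) (Fin p) ℝ) {B : Matrix (Fin d) (Fin m) ℝ}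
    (hB : ‖LinearMap.toContinuousLinearMap (Matrix.toEuclideanLin (𝕜 := ℝ) Bᵀ)‖ ≤
      64 * √((m : ℝ) / d)) (x : EuclideanSpace ℝ (Fin p)) (v : EuclideanSpace ℝ (Fin d)) :
    ‖WithLp.toLp 2 (backTop τ A B W x v)‖ ^ 2 ≤ 64 ^ 2 * (m / d) * ‖v‖ ^ 2 := by
  refine (sq_norm_signDiag_mulVec_le _ _).trans ?_
  have h1 : ‖WithLp.toLp 2 (Bᵀ *ᵥ v.ofLp)‖ ≤ 64 * √((m : ℝ) / d) * ‖v‖ :=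
    ((LinearMap.toContinuousLinearMap (Matrix.toEuclideanLin (𝕜 := ℝ) Bᵀ)).le_opNorm v).trans
      (by gcongr)
  refine (pow_le_pow_left₀ (norm_nonneg _) h1 2).trans_eq ?_
  rw [mul_pow, mul_pow, Real.sq_sqrt (by positivity)]

theorem frobSq_sum_vecMulVec_le {n k : ℕ} (a : Fin n → Fin m → ℝ) (b : Fin n → Fin k → ℝ) :
    frobSq (∑ i, Matrix.vecMulVec (a i) (b i)) ≤
      (∑ i, ‖WithLp.toLp 2 (a i)‖ ^ 2) * ∑ i, ‖WithLp.toLp 2 (b i)‖ ^ 2 := by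
  simp_rw [EuclideanSpace.real_norm_sq_eq]
  rw [Finset.sum_comm, Finset.sum_comm (f := fun i j => (b i j) ^ 2), Finset.sum_mul_sum, frobSq]
  refine Finset.sum_le_sum fun r _ => Finset.sum_le_sum fun s _ => ?_
  simp only [Matrix.sum_apply, Matrix.vecMulVec_apply]
  exact Finset.sum_mul_sq_le_sq_mul_sq _ _ _

end NetworkBounds

/-! ### Gradient bounds on the good event -/

/-- The gradient bounds hold deterministically on the event that the weights, the output matrix and
the first layer are well behaved. -/
theorem gradientUpperBound_of_good {m p d K n : ℕ} {τ : ℝ} {x : Fin n → EuclideanSpace ℝ (Fin p)}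
    (y : Fin n → EuclideanSpace ℝ (Fin d)) {θ : InitSpace m p d K} (hKm : K + 1 ≤ m) (hτ : 0 < τ)
    (hτ' : τ * (√(K + 1 : ℕ) * Real.log m) ≤ 1 / 10 ^ 7) (hS : IntervalSumBound θ.W)
    (hB : ‖LinearMap.toContinuousLinearMap (Matrix.toEuclideanLin (𝕜 := ℝ) (θ.B)ᵀ)‖ ≤
      64 * √((m : ℝ) / d))
    (hA : ∑ i, ‖WithLp.toLp 2 (θ.A *ᵥ (x i).ofLp)‖ ^ 2 ≤ Real.exp 24 * n) :
    GradientUpperBound (8 * Real.exp 4 ^ 2 * 65 ^ 2 * 64 ^ 2 * Real.exp 24) τ x y θ := by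
  intro w hw W hW
  have hF : ∑ i, ‖output τ θ.A θ.B W (x i) - y i‖ ^ 2 = 2 * objective τ x y θ.A θ.B W := by
    rw [objective, Finset.mul_sum]
    exact Finset.sum_congr rfl fun i _ => by ring
  have hF0 : 0 ≤ objective τ x y θ.A θ.B W := by unfold objective; positivity
  set F := objective τ x y θ.A θ.B W
  have hh : ∀ k, ∑ i, ‖WithLp.toLp 2 (hiddenRep τ θ.A W (x i) k)‖ ^ 2 ≤
      2 * Real.exp 4 * (Real.exp 24 * n) := by
    intro k
    refine (Finset.sum_le_sum fun i _ => sq_norm_hiddenRep_le hKm hτ hτ' hw.2 hS hW θ.A (x i) k).trans ?_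
    rw [← Finset.mul_sum]
    gcongr
  have ht : ∑ i, ‖WithLp.toLp 2 (backTop τ θ.A θ.B W (x i)
      (output τ θ.A θ.B W (x i) - y i))‖ ^ 2 ≤ 64 ^ 2 * (m / d) * (2 * F) := by
    refine (Finset.sum_le_sum fun i _ => sq_norm_backTop_le θ.A hB (x i) _).trans ?_
    rw [← Finset.mul_sum, hF]
  have he : 1 ≤ Real.exp 4 := Real.one_le_exp (by norm_num)
  constructor
  · intro k
    have e : gradResidual τ x y θ.A θ.B W k = ∑ i, Matrix.vecMulVec
        (τ • (signDiag (preAct τ θ.A W (x i) k) *ᵥ backHidden τ θ.A θ.B W (x i)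
          (output τ θ.A θ.B W (x i) - y i) k.succ)) (hiddenRep τ θ.A W (x i) k.castSucc) := by
      simp only [gradResidual, backResidual, Matrix.smul_vecMulVec]
    rw [e]
    refine (frobSq_sum_vecMulVec_le _ _).trans ?_
    have hb : ∑ i, ‖WithLp.toLp 2 (τ • (signDiag (preAct τ θ.A W (x i) k) *ᵥ
        backHidden τ θ.A θ.B W (x i) (output τ θ.A θ.B W (x i) - y i) k.succ))‖ ^ 2 ≤
        τ ^ 2 * (2 * Real.exp 4 * (65 ^ 2 * (64 ^ 2 * (m / d) * (2 * F)))) := by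
      have h1 : ∀ i, ‖WithLp.toLp 2 (τ • (signDiag (preAct τ θ.A W (x i) k) *ᵥ
          backHidden τ θ.A θ.B W (x i) (output τ θ.A θ.B W (x i) - y i) k.succ))‖ ^ 2 ≤
          τ ^ 2 * (2 * Real.exp 4 * (65 ^ 2 * ‖WithLp.toLp 2 (backTop τ θ.A θ.B W (x i)
            (output τ θ.A θ.B W (x i) - y i))‖ ^ 2)) := by
        intro i
        rw [WithLp.toLp_smul, norm_smul, mul_pow, Real.norm_eq_abs, sq_abs]
        refine mul_le_mul_of_nonneg_left ?_ (sq_nonneg τ)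
        refine (sq_norm_backHidden_le hKm hτ hτ' hw.2 hS hW θ.A θ.B (x i) _ k).trans ?_
        refine mul_le_mul_of_nonneg_left ?_ (by positivity)
        rw [← mul_pow]
        refine pow_le_pow_left₀ (norm_nonneg _) ?_ 2
        rw [backHidden, Fin.reverseInduction_last]
        refine (norm_toLp_mulVec_le _ _).trans ?_
        rw [spectralNorm_transpose]
        gcongr
        exact spectralNorm_top_le hw.2 hS hW
      refine (Finset.sum_le_sum fun i _ => h1 i).trans ?_
      simp_rw [← Finset.mul_sum]
      gcongr
    refine (mul_le_mul hb (hh k.castSucc) (Finset.sum_nonneg fun _ _ => sq_nonneg _)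
      (by positivity)).trans_eq ?_
    ring
  · have e : gradTop τ x y θ.A θ.B W = ∑ i, Matrix.vecMulVec (backTop τ θ.A θ.B W (x i)
        (output τ θ.A θ.B W (x i) - y i)) (hiddenRep τ θ.A W (x i) (Fin.last K)) := rfl
    rw [e]
    refine (frobSq_sum_vecMulVec_le _ _).trans ((mul_le_mul ht (hh (Fin.last K))
      (Finset.sum_nonneg fun _ _ => sq_nonneg _) (by positivity)).trans ?_)
    have h2 : 0 ≤ F / d * (m * n) := by positivity
    calc 64 ^ 2 * ((m : ℝ) / d) * (2 * F) * (2 * Real.exp 4 * (Real.exp 24 * n)) =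
          4 * Real.exp 4 * 64 ^ 2 * Real.exp 24 * (F / d * (m * n)) := by ring
      _ ≤ _ := by
          refine mul_le_mul_of_nonneg_right ?_ h2
          nlinarith [mul_pos (Real.exp_pos 4) (Real.exp_pos 24)]

/-! ### Union bound over intervals of layers -/

section Probability

variable {m p d K : ℕ}

theorem measure_interval_sum_gt_le (hm : 1 ≤ m) (a T : ℕ) :
    initLaw m p d K {θ | a + T ≤ K + 1 ∧
        64 * √T < ‖∑ l ∈ Finset.range T, weightOp θ.W (a + l)‖} ≤
      ENNReal.ofReal (Real.exp (-(12 * m))) := by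
  by_cases haT : a + T ≤ K + 1
  · rcases Nat.eq_zero_or_pos T with rfl | hT
    · simp
    have hlt : ∀ l ∈ Finset.Ico a (a + T), l < K + 1 := fun l hl => by
      rw [Finset.mem_Ico] at hl; omega
    set s : Finset (Fin (K + 1)) := (Finset.Ico a (a + T)).attachFin hlt with hs
    have hcard : s.card = T := by rw [hs, Finset.card_attachFin, Nat.card_Ico]; omega
    have hsum : ∀ θ : InitSpace m p d K, ∑ l ∈ Finset.range T, weightOp θ.W (a + l) =
        ∑ l ∈ s, Matrix.toEuclideanCLM (n := Fin m) (𝕜 := ℝ) (θ.W l) := by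
      intro θ
      refine Finset.sum_bij' (fun l hl => ⟨a + l, by rw [Finset.mem_range] at hl; omega⟩)
        (fun l _ => (l : ℕ) - a) ?_ ?_ ?_ ?_ ?_
      · intro l hl; rw [Finset.mem_range] at hl; simp [hs, hl]
      · intro l hl; simp [hs] at hl ⊢; omega
      · intro l hl; simp
      · intro l hl; simp [hs] at hl; ext; simp; omega
      · intro l hl; rw [weightOp_of_lt]
    have key := measure_sum_weights_gt_le (p := p) (d := d) hm s
      (Finset.card_pos.1 (by omega))
    rw [hcard] at key
    refine (measure_mono fun θ hθ => ?_).trans key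
    replace hθ : a + T ≤ K + 1 ∧ 64 * √T < ‖∑ l ∈ Finset.range T, weightOp θ.W (a + l)‖ := hθ
    rw [hsum] at hθ
    exact hθ.2
  · simp [haT]

theorem measure_not_intervalSumBound_le (hm : 1 ≤ m) :
    initLaw m p d K {θ | ¬ IntervalSumBound θ.W} ≤
      (((K + 2) ^ 2 : ℕ) : ℝ≥0∞) * ENNReal.ofReal (Real.exp (-(12 * m))) := by
  have hsub : {θ : InitSpace m p d K | ¬ IntervalSumBound θ.W} ⊆
      ⋃ q ∈ Finset.range (K + 2) ×ˢ Finset.range (K + 2), {θ | q.1 + q.2 ≤ K + 1 ∧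
        64 * √(q.2 : ℕ) < ‖∑ l ∈ Finset.range q.2, weightOp θ.W (q.1 + l)‖} := by
    intro θ hθ
    replace hθ : ¬ IntervalSumBound θ.W := hθ
    unfold IntervalSumBound at hθ
    push Not at hθ
    obtain ⟨a, T, h1, h2⟩ := hθ
    simp only [Set.mem_iUnion]
    exact ⟨(a, T), by simp; omega, h1, h2⟩
  refine (measure_mono hsub).trans ((measure_biUnion_finset_le _ _).trans
    ((Finset.sum_le_sum fun q _ => measure_interval_sum_gt_le hm q.1 q.2).trans_eq ?_))
  rw [Finset.sum_const, Finset.card_product, Finset.card_range, nsmul_eq_mul, sq]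

end Probability

end ResNet

/-! ### Assembly of the main theorem -/

theorem mainTheorem7 :
    ∃ c₀ > (0 : ℝ), ∃ C₀ > (0 : ℝ), ∃ C > (0 : ℝ), ∃ c > (0 : ℝ),
      ∀ (n p d m K : ℕ) (τ : ℝ)
        (x : Fin n → EuclideanSpace ℝ (Fin p)) (y : Fin n → EuclideanSpace ℝ (Fin d)),
        1 ≤ d → K + 1 ≤ m → C₀ * d ≤ m → (∀ i, ‖x i‖ = 1) →
        0 < τ → τ * (Real.sqrt (K + 1 : ℕ) * Real.log m) ≤ c₀ →
        ResNet.initLaw m p d K {θ | ¬ ResNet.GradientUpperBound C τ x y θ} ≤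
          ENNReal.ofReal (Real.exp (-(c * m))) := by
  refine ⟨1 / 10 ^ 7, by norm_num, 1, one_pos,
    8 * Real.exp 4 ^ 2 * 65 ^ 2 * 64 ^ 2 * Real.exp 24, by positivity, 1, one_pos, ?_⟩
  intro n p d m K τ x y hd hKm hdm hx hτ hτ'
  have hm : 1 ≤ m := by omega
  have hdm' : d ≤ m := by rw [one_mul] at hdm; exact_mod_cast hdm
  have hsub : {θ : ResNet.InitSpace m p d K | ¬ ResNet.GradientUpperBound
      (8 * Real.exp 4 ^ 2 * 65 ^ 2 * 64 ^ 2 * Real.exp 24) τ x y θ} ⊆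
      {θ | ¬ ResNet.IntervalSumBound θ.W} ∪
      ({θ | 64 * √((m : ℝ) / d) <
        ‖LinearMap.toContinuousLinearMap (Matrix.toEuclideanLin (𝕜 := ℝ) (θ.B)ᵀ)‖} ∪
      {θ | Real.exp 24 * n < ∑ i, ‖WithLp.toLp 2 (θ.A *ᵥ (x i).ofLp)‖ ^ 2}) := by
    intro θ hθ
    by_contra hcon
    simp only [Set.mem_union, not_or] at hcon
    obtain ⟨h1, h2, h3⟩ := hcon
    exact hθ (ResNet.gradientUpperBound_of_good y hKm hτ hτ' (not_not.1 h1) (not_lt.1 h2)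
      (not_lt.1 h3))
  refine (measure_mono hsub).trans ((measure_union_le _ _).trans ((add_le_add
    (ResNet.measure_not_intervalSumBound_le hm) ((measure_union_le _ _).trans (add_le_add
    (ResNet.measure_output_gt_le hm hd hdm') (ResNet.measure_sum_sq_norm_gt_le hm x hx)))).trans ?_))
  rw [← ENNReal.ofReal_natCast, ← ENNReal.ofReal_mul (by positivity),
    ← ENNReal.ofReal_add (by positivity) (by positivity),
    ← ENNReal.ofReal_add (by positivity) (by positivity)]
  apply ENNReal.ofReal_le_ofReal
  have hm1 : (1 : ℝ) ≤ m := by exact_mod_cast hm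
  -- Depth at most `m` keeps the number of intervals below `exp (2 m)`, so the exponent `12 m` of
  -- the tails easily covers all bad events.
  have hK : ((K + 2 : ℕ) : ℝ) ≤ m + 1 := by exact_mod_cast (by omega : K + 2 ≤ m + 1)
  have h1 : ((K + 2 : ℕ) : ℝ) ^ 2 ≤ Real.exp m ^ 2 :=
    pow_le_pow_left₀ (by positivity) (hK.trans (Real.add_one_le_exp _)) 2
  have h2 : (2 : ℝ) ≤ Real.exp m ^ 2 := by
    nlinarith [Real.add_one_le_exp (m : ℝ)]
  have h3 : 2 * Real.exp m ^ 2 ≤ Real.exp (11 * m) := by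
    calc 2 * Real.exp m ^ 2 ≤ Real.exp m ^ 2 * Real.exp m ^ 2 := by gcongr
      _ = Real.exp (4 * m) := by rw [← pow_add, ← Real.exp_nat_mul]; norm_num
      _ ≤ _ := Real.exp_le_exp.2 (by linarith)
  have h4 : Real.exp (11 * m) * Real.exp (-(12 * m)) = Real.exp (-(1 * m)) := by
    rw [← Real.exp_add]; ring_nf
  rw [← h4]
  push_cast at h1 ⊢
  nlinarith [Real.exp_pos (-(12 * (m : ℝ)))]
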